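/- **Theorem 2.6.** Let $G$ be a (real or complex) Lie group with Lie algebra $\mathfrak g$, and let $\pi:G\to\operatorname{Aut}(V)$ be a finite-dimensional representation (smooth and with $V$ a real vector space if $G$ is real; holomorphic and with $V$ a complex vector space if $G$ is complex). Say that a representation $\rho:L\to \operatorname{Aut}(V)$ of a Lie group $L$ with Lie algebra $\mathfrak l$ *admits a Cayley mapping* if its differential $\rho':\mathfrak l\to\operatorname{End}(V)$ is injective and the bilinear form $(S,T)\mapsto\operatorname{tr}(ST)$ on $\operatorname{End}(V)$ is non-degenerate on $\rho'(\mathfrak l)$. In that case let $\operatorname{pr}_\rho:\operatorname{End}(V)\to\rho'(\mathfrak l)$ be the orthogonal projection for this form and define $\Phi_\rho:L\to\mathfrak l$ by $\rho'\circ\Phi_\rho=\operatorname{pr}_\rho\circ\rho$. Assume that $\pi$ admits a Cayley mapping. Let $A\subseteq G$ be a subset, and let $H=\bigl(\bigcap_{a\in A}G^a\bigr)_o$, where $G^a$ is the centralizer of $a$ in $G$, be its connected centralizer, i.e. the identity component of the centralizer of $A$. It is an embedded Lie subgroup of $G$; let $\mathfrak h\subseteq\mathfrak g$ be its Lie algebra.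 Suppose that $H$ is reductive, in the sense that one of the following holds: 1. $H$ has a compact real form: there is a compact subgroup $K\subseteq H$ with Lie algebra $\mathfrak k$ such that $\mathfrak h=\mathfrak k\oplus i\,\mathfrak k$ if $H$ is complex, respectively $\mathfrak h=\mathfrak k$ (that is, $H$ is compact) if $H$ is real; 2. the Lie algebra $\mathfrak h$ is reductive and $\pi$ maps each element of the connected center of $H$ (the identity component of the center of $H$) to a semisimple transformation. Then $\pi|H:H\to\operatorname{Aut}(V)$ admits a Cayley mapping, and $$\Phi_\pi|H=\Phi_{\pi|H}:H\to\mathfrak h .$$ -/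

import Mathlib

open scoped Manifold ContDiff

noncomputable section

/-- Over `ℝ` and `ℂ` a smooth Lie group is regular enough to have a Lie algebra in Mathlib. -/
instance instLEInftyMinSmoothness {𝕜 : Type*} [RCLike 𝕜] :
    ENat.LEInfty (minSmoothness 𝕜 3) := by
  rw [minSmoothness_of_isRCLikeNormedField]
  infer_instance

/-- The identity component of a subgroup `K` (with the subspace topology), as a subgroup of the
ambient group. -/
def identityComponent {G : Type*} [Group G] [TopologicalSpace G] [IsTopologicalGroup G]
    (K : Subgroup G) : Subgroup G :=
  (Subgroup.connectedComponentOfOne K).map K.subtype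

/-- The connected centralizer `(G^A)_o` of a subset `A` of `G`. -/
abbrev connectedCentralizer {G : Type*} [Group G] [TopologicalSpace G] [IsTopologicalGroup G]
    (A : Set G) : Subgroup G :=
  identityComponent (Subgroup.centralizer A)

section Cayley

variable {𝕜 : Type*} [RCLike 𝕜]
  {E : Type*} [NormedAddCommGroup E] [NormedSpace 𝕜 E]
  {G : Type*} [Group G] [TopologicalSpace G] [ChartedSpace E G]
  {V : Type*} [NormedAddCommGroup V] [NormedSpace 𝕜 V]

/-- The differential `π' : 𝔤 → End V` at the identity of a representation `π` of `G` on `V`. -/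
def repDeriv (π : G →* (V →L[𝕜] V)) : GroupLieAlgebra 𝓘(𝕜, E) G →ₗ[𝕜] (V →L[𝕜] V) where
  toFun X := mfderiv 𝓘(𝕜, E) 𝓘(𝕜, V →L[𝕜] V) π (1 : G) X
  map_add' X Y := map_add (mfderiv 𝓘(𝕜, E) 𝓘(𝕜, V →L[𝕜] V) π (1 : G)) X Y
  map_smul' c X := map_smul (mfderiv 𝓘(𝕜, E) 𝓘(𝕜, V →L[𝕜] V) π (1 : G)) c X

/-- The inner product `(A, B) ↦ tr (A B)` on `End V`. -/
def endTraceForm (𝕜 V : Type*) [RCLike 𝕜] [NormedAddCommGroup V] [NormedSpace 𝕜 V] :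
    LinearMap.BilinForm 𝕜 (V →L[𝕜] V) :=
  LinearMap.mk₂ 𝕜 (fun A B => LinearMap.trace 𝕜 V ((A : V →ₗ[𝕜] V) * (B : V →ₗ[𝕜] V)))
    (by intro A B C; simp [add_mul]) (by intro c A B; simp)
    (by intro A B C; simp [mul_add]) (by intro c A B; simp)

lemma endTraceForm_isRefl : (endTraceForm 𝕜 V).IsRefl := by
  intro A B h
  simp only [endTraceForm, LinearMap.mk₂_apply] at h ⊢
  rwa [LinearMap.trace_mul_comm]

/-- `π` admits a Cayley mapping: `π'` is injective and the trace form of `End V` restricts to a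
non-degenerate inner product on `π'(𝔤)`. -/
structure AdmitsCayley (π : G →* (V →L[𝕜] V)) : Prop where
  injective : Function.Injective (repDeriv (E := E) π)
  nondegenerate :
    ((endTraceForm 𝕜 V).restrict (LinearMap.range (repDeriv (E := E) π))).Nondegenerate

/-- The projection `pr_π : End V → π'(𝔤)`, orthogonal for the trace form. -/
def cayleyProj [FiniteDimensional 𝕜 V] (π : G →* (V →L[𝕜] V)) (hπ : AdmitsCayley (E := E) π) :
    (V →L[𝕜] V) →ₗ[𝕜] LinearMap.range (repDeriv (E := E) π) :=
  Submodule.projectionOnto _ _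
    (LinearMap.BilinForm.isCompl_orthogonal_of_restrict_nondegenerate
      (endTraceForm_isRefl (𝕜 := 𝕜) (V := V)) hπ.nondegenerate)

/-- The generalized Cayley mapping `Φ_π : G → 𝔤`, determined by `π' ∘ Φ_π = pr_π ∘ π`. -/
def cayleyMap [FiniteDimensional 𝕜 V] (π : G →* (V →L[𝕜] V)) (hπ : AdmitsCayley (E := E) π)
    (g : G) : GroupLieAlgebra 𝓘(𝕜, E) G :=
  (LinearEquiv.ofInjective (repDeriv (E := E) π) hπ.injective).symm (cayleyProj π hπ (π g))

/-- A Lie algebra (over a field of characteristic zero) is reductive if its radical is its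
center. -/
def IsReductiveLieAlgebra (𝕜 L : Type*) [Field 𝕜] [LieRing L] [LieAlgebra 𝕜 L] : Prop :=
  LieAlgebra.radical 𝕜 L = LieAlgebra.center 𝕜 L

/-- Every element of the connected center of `G` is mapped by `π` to a semisimple endomorphism.
(Over `ℝ` this is the same as semisimplicity in the complexification of `V`.) -/
def ConnectedCenterActsSemisimply [IsTopologicalGroup G] (π : G →* (V →L[𝕜] V)) : Prop :=
  ∀ z ∈ identityComponent (Subgroup.center G),
    Module.End.IsSemisimple ((π z : V →L[𝕜] V) : V →ₗ[𝕜] V)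

/-- The Lie algebra of a closed subgroup `K` of the Lie group `G`, as a subset of `𝔤`: the `X`
with `exp (t X) ∈ K` for all real `t`, where `s ↦ exp (s X)` is the (over `ℂ`: holomorphic)
one-parameter group `γ` with `γ' 0 = X`. -/
def subgroupLie (𝕜 E : Type*) [RCLike 𝕜] [NormedAddCommGroup E] [NormedSpace 𝕜 E]
    {G : Type*} [Group G] [TopologicalSpace G] [ChartedSpace E G] (K : Subgroup G) :
    Set (GroupLieAlgebra 𝓘(𝕜, E) G) :=
  {X | ∃ γ : 𝕜 → G, ContMDiff 𝓘(𝕜, 𝕜) 𝓘(𝕜, E) ∞ γ ∧ (∀ s t, γ (s + t) = γ s * γ t) ∧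
    (mfderiv 𝓘(𝕜, 𝕜) 𝓘(𝕜, E) γ 0 (1 : 𝕜) : E) = X ∧ ∀ t : ℝ, γ (t : 𝕜) ∈ K}

/-- `G` has a compact real form: there is a compact subgroup `K` such that `𝔤 = 𝔨 ⊕ i 𝔨`, i.e. `𝔤`
is the complexification of `𝔨 = Lie K`. This is reductivity for complex Lie groups. Over `𝕜 = ℝ`,
where `RCLike.I = 0`, it says that `Lie K = 𝔤`; for connected `G` this means that `G` is
compact. -/
def HasCompactRealForm (𝕜 E : Type*) [RCLike 𝕜] [NormedAddCommGroup E] [NormedSpace 𝕜 E]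
    (G : Type*) [Group G] [TopologicalSpace G] [ChartedSpace E G] : Prop :=
  ∃ K : Subgroup G, IsCompact (K : Set G) ∧
    (∀ X : GroupLieAlgebra 𝓘(𝕜, E) G, ∃ Y ∈ subgroupLie 𝕜 E K, ∃ Z ∈ subgroupLie 𝕜 E K,
      X = Y + (RCLike.I : 𝕜) • Z) ∧
    (∀ Y ∈ subgroupLie 𝕜 E K, ∀ Z ∈ subgroupLie 𝕜 E K,
      Y + (RCLike.I : 𝕜) • Z = 0 → Y = 0 ∧ (RCLike.I : 𝕜) • Z = 0)

/-- Reductivity of a (real or complex) Lie group `G` with respect to its representation `π`: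
either `G` has a compact real form, or the Lie algebra of `G` is reductive and `π` maps the
connected center of `G` to semisimple transformations. -/
def IsReductiveGroup [FiniteDimensional 𝕜 E] [CompleteSpace E] [LieGroup 𝓘(𝕜, E) ∞ G]
    [IsTopologicalGroup G] (π : G →* (V →L[𝕜] V)) : Prop :=
  HasCompactRealForm 𝕜 E G ∨
    (IsReductiveLieAlgebra 𝕜 (GroupLieAlgebra 𝓘(𝕜, E) G) ∧ ConnectedCenterActsSemisimply π)

end Cayley

end

/-! Write σ for the restriction of π to H. Conjugation by π(a) preserves both π'(𝔤) and the trace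
form, so it commutes with the projection onto π'(𝔤). Hence if W commutes with π(A), so does its
projection π'(X) (`commute_cayleyProj`). The local one-parameter group of X then commutes with A
modulo ker π. This kernel is discrete, so the curve really centralizes A, and X lies in 𝔥
(`mem_range_repDeriv_of_commute`). Thus the projection sends the commutant of π(A) into σ'(𝔥). For W
= π(h) the remainder is orthogonal to π'(𝔤), which contains σ'(𝔥), so the two projections agree on
π(h) as soon as the trace form is non-degenerate on σ'(𝔥).

With a compact real form, non-degeneracy is the unitary trick: for an averaged hermitian form, σ'(Y
+ iZ) has adjoint -σ'(Y - iZ), and tr(CC*) = 0 forces C = 0.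

For reductive 𝔥, let Y be in the kernel of the trace form on 𝔥. Each power of σ'(Y) commutes with
π(A), so it may be replaced by its projection in σ'(𝔥) when paired with σ'(Y). All traces of
positive powers therefore vanish, and σ'(Y) is nilpotent. By Engel the kernel is a nilpotent ideal,
so it lies in the radical, which is the center. Finally exp(tσ'(Y)) is both unipotent and semisimple
for small t, which gives Y = 0. -/

/-! ### Nilpotency from traces, Engel's theorem, and positive definite forms. -/

section LinearAlgebra

/-- An endomorphism all of whose positive powers have trace zero is nilpotent. -/
lemma isNilpotent_of_trace_pow_succ_eq_zero {K V : Type*} [Field K] [CharZero K] [AddCommGroup V]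
    [Module K V] [FiniteDimensional K V] (f : Module.End K V)
    (h : ∀ k : ℕ, LinearMap.trace K V (f ^ (k + 1)) = 0) : IsNilpotent f := by
  open Polynomial in
  have htr : ∀ r : K[X], LinearMap.trace K V (aeval f (X * r)) = 0 := by
    intro r
    induction r using Polynomial.induction_on' with
    | add p q hp hq => rw [mul_add, map_add, map_add, hp, hq, add_zero]
    | monomial n a =>
      have : (X * monomial n a : K[X]) = monomial (n + 1) a := by
        rw [X_mul, monomial_mul_X]
      rw [this, aeval_monomial, Module.algebraMap_end_eq_smul_id, smul_mul_assoc, map_smul,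
        ← Module.End.one_eq_id, one_mul, h n, smul_zero]
  -- Fitting decomposition: the minimal polynomial is X^m q with q prime to X. From a X^(m+1) + b q
  -- = 1 one gets an idempotent a(f) f^(m+1), projecting onto the part where f is invertible. The
  -- exponent m + 1 keeps a factor X even if m = 0, so its trace is zero; in characteristic zero the
  -- idempotent vanishes.
  obtain ⟨q, hq, hdvd⟩ := exists_eq_pow_rootMultiplicity_mul_and_not_dvd (minpoly K f)
    (minpoly.ne_zero (Algebra.IsIntegral.isIntegral f)) 0
  rw [C_0, sub_zero] at hq hdvd
  set m := rootMultiplicity 0 (minpoly K f)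
  have hcop : IsCoprime (X ^ (m + 1)) q :=
    (Polynomial.irreducible_X.coprime_iff_not_dvd.2 hdvd).pow_left
  obtain ⟨a, b, hab⟩ := hcop
  have h0 : aeval f (X ^ m * q) = 0 := by rw [← hq, minpoly.aeval]
  have hidem : IsIdempotentElem (aeval f (a * X ^ (m + 1))) := by
    have : a * X ^ (m + 1) * (a * X ^ (m + 1)) =
        a * X ^ (m + 1) - a * b * X * (X ^ m * q) := by linear_combination (a * X ^ (m + 1)) * hab
    rw [IsIdempotentElem, ← map_mul, this, map_sub, map_mul _ (a * b * X), h0, mul_zero, sub_zero]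
  have hzero : aeval f (a * X ^ (m + 1)) = 0 := by
    refine LinearMap.IsIdempotentElem.eq_zero_of_trace_eq_zero hidem ?_
    rw [show a * X ^ (m + 1) = X * (a * X ^ m) by ring, htr]
  refine ⟨m, ?_⟩
  have : (X ^ m : K[X]) = X ^ m * (a * X ^ (m + 1)) + b * (X ^ m * q) := by
    linear_combination -(X ^ m) * hab
  have h2 := congrArg (aeval f) this
  rw [map_add, map_mul, hzero, map_mul _ b, h0] at h2
  simpa using h2

attribute [local instance] LieRing.ofAssociativeRing

/-- A Lie ideal which acts by nilpotent endomorphisms in a faithful representation is contained in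
the radical. -/
lemma le_radical_of_forall_isNilpotent {K L V : Type*} [Field K] [LieRing L] [LieAlgebra K L]
    [FiniteDimensional K L] [AddCommGroup V] [Module K V]
    (ρ : L →ₗ[K] Module.End K V) (hρ : Function.Injective ρ)
    (hlie : ∀ x y, ρ ⁅x, y⁆ = ρ x * ρ y - ρ y * ρ x) (I : LieIdeal K L)
    (hI : ∀ x ∈ I, IsNilpotent (ρ x)) : I ≤ LieAlgebra.radical K L := by
  rw [← LieAlgebra.LieIdeal.solvable_iff_le_radical]
  -- Engel: ρ intertwines ad x on I with ad (ρ x) on End V, which is nilpotent because ρ x is.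
  have : LieRing.IsNilpotent I := by
    rw [LieAlgebra.isNilpotent_iff_forall (R := K)]
    intro x
    obtain ⟨n, hn⟩ := LieAlgebra.ad_nilpotent_of_nilpotent (R := K) (hI x x.2)
    refine ⟨n, LinearMap.ext fun y => ?_⟩
    have key : ∀ k : ℕ, ρ (((LieAlgebra.ad K I x) ^ k) y : I) =
        ((LieAlgebra.ad K (Module.End K V) (ρ x)) ^ k) (ρ y) := by
      intro k
      induction k with
      | zero => rfl
      | succ k ih =>
        rw [pow_succ', Module.End.mul_apply, pow_succ', Module.End.mul_apply, ← ih]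
        exact hlie _ _
    have h := key n
    rw [hn, LinearMap.zero_apply] at h
    exact Subtype.ext (hρ (h.trans (map_zero ρ).symm))
  infer_instance

open Matrix in
open scoped ComplexOrder MatrixOrder Matrix.Norms.L2Operator in
/-- If `C` is, up to the sign, adjoint to `D` for a positive definite hermitian form and
`tr (C D) = 0`, then `C = 0`. -/
lemma eq_zero_of_trace_mul_of_posDef {𝕜 n : Type*} [RCLike 𝕜] [Fintype n] [DecidableEq n]
    {P C D : Matrix n n 𝕜} (hP : P.PosDef) (h : Cᴴ * P + P * D = 0)
    (htr : (C * D).trace = 0) : C = 0 := by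
  obtain ⟨Q, hQ⟩ : ∃ Q : Matrix n n 𝕜, P = Qᴴ * Q :=
    CStarAlgebra.nonneg_iff_eq_star_mul_self.1 hP.posSemidef.nonneg
  have hPu : IsUnit P.det := (Matrix.isUnit_iff_isUnit_det _).1 hP.isUnit
  have hQu : IsUnit Q.det := by
    rw [hQ, det_mul] at hPu
    exact isUnit_of_mul_isUnit_right hPu
  have hQH : IsUnit Qᴴ.det := by rw [det_conjTranspose]; exact hQu.star
  -- Conjugation by Q turns the form P into the standard one, where D becomes minus the adjoint of
  -- C.
  have hD : Q * D * Q⁻¹ = -(Q * C * Q⁻¹)ᴴ := by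
    have h1 : Qᴴ * (Q * D) = -(Cᴴ * (Qᴴ * Q)) := by
      rw [← Matrix.mul_assoc, ← hQ]
      exact eq_neg_of_add_eq_zero_right h
    have h2 : Q * D = -(Qᴴ⁻¹ * (Cᴴ * Qᴴ * Q)) := by
      rw [← nonsing_inv_mul_cancel_left _ (Q * D) hQH, h1]
      simp [Matrix.mul_assoc]
    rw [h2, conjTranspose_mul, conjTranspose_mul, conjTranspose_nonsing_inv]
    simp only [Matrix.neg_mul, Matrix.mul_assoc, mul_nonsing_inv _ hQu, Matrix.mul_one]
  have h3 : ((Q * C * Q⁻¹) * (Q * C * Q⁻¹)ᴴ).trace = 0 := by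
    rw [← neg_eq_zero, ← trace_neg, ← Matrix.mul_neg, ← hD]
    rw [show Q * C * Q⁻¹ * (Q * D * Q⁻¹) = Q * (C * (Q⁻¹ * Q) * D * Q⁻¹) by
      simp only [Matrix.mul_assoc], nonsing_inv_mul _ hQu, trace_mul_comm]
    simpa only [Matrix.mul_one, Matrix.mul_assoc, nonsing_inv_mul _ hQu] using htr
  have h4 : Q * C * Q⁻¹ = 0 := Matrix.trace_mul_conjTranspose_self_eq_zero_iff.1 h3
  calc C = Q⁻¹ * (Q * C * Q⁻¹) * Q := by
        rw [show Q⁻¹ * (Q * C * Q⁻¹) * Q = (Q⁻¹ * Q) * C * (Q⁻¹ * Q) by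
          simp only [Matrix.mul_assoc], nonsing_inv_mul _ hQu, Matrix.one_mul, Matrix.mul_one]
    _ = 0 := by rw [h4, Matrix.mul_zero, Matrix.zero_mul]

end LinearAlgebra

/-! ### Exponentials of nilpotent operators. -/

section Exponential

variable {𝕜 V : Type*} [RCLike 𝕜] [NormedAddCommGroup V] [NormedSpace 𝕜 V] [FiniteDimensional 𝕜 V]

omit [FiniteDimensional 𝕜 V] in
/-- Real difference quotients converge to the derivative. -/
lemma HasDerivAt.tendsto_inv_smul_sub {f : 𝕜 → V} {v : V} (hf : HasDerivAt f v 0) (δ : ℝ)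
    (hδ : 0 < δ) : Filter.Tendsto
      (fun n : ℕ => (((δ / (n + 2) : ℝ) : 𝕜))⁻¹ • (f ((δ / (n + 2) : ℝ) : 𝕜) - f 0))
      Filter.atTop (nhds v) := by
  rw [hasDerivAt_iff_tendsto_slope] at hf
  -- The shift by 2 keeps every term strictly between 0 and δ, where the local curves are
  -- controlled.
  have hseq : Filter.Tendsto (fun n : ℕ => ((δ / (n + 2) : ℝ) : 𝕜)) Filter.atTop
      (nhdsWithin 0 {0}ᶜ) := by
    refine tendsto_nhdsWithin_iff.2 ⟨?_, .of_forall fun n => ?_⟩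
    · have : Filter.Tendsto (fun n : ℕ => δ / ((n : ℝ) + 2)) Filter.atTop (nhds 0) :=
        Filter.Tendsto.const_div_atTop
          (Filter.tendsto_atTop_add_const_right _ _ tendsto_natCast_atTop_atTop) _
      simpa only [RCLike.ofReal_zero, Function.comp_def] using
        ((RCLike.continuous_ofReal (K := 𝕜)).tendsto 0).comp this
    · have : (0 : ℝ) < δ / (n + 2) := by positivity
      simpa only [Set.mem_compl_iff, Set.mem_singleton_iff, RCLike.ofReal_eq_zero] using this.ne'
  refine (hf.comp hseq).congr fun n => ?_
  rw [Function.comp_apply, slope_def_module, sub_zero]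

lemma hasDerivAt_exp_smul_zero {𝔸 : Type*} [NormedRing 𝔸] [NormedAlgebra 𝕜 𝔸] [CompleteSpace 𝔸]
    (B : 𝔸) : HasDerivAt (fun s : 𝕜 => NormedSpace.exp (s • B)) B 0 := by
  simpa using hasDerivAt_exp_smul_const B (0 : 𝕜)

/-- The series without its constant term is a finite sum of commuting nilpotents. -/
lemma isNilpotent_exp_sub_one {𝔸 : Type*} (𝕜 : Type*) [RCLike 𝕜] [NormedRing 𝔸]
    [NormedAlgebra 𝕜 𝔸] [CompleteSpace 𝔸] {N : 𝔸} (hN : IsNilpotent N) :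
    IsNilpotent (NormedSpace.exp N - 1) := by
  obtain ⟨n, hn⟩ := hN
  have h1 : NormedSpace.exp N - 1 =
      ∑ k ∈ Finset.range n, (((k + 1).factorial : 𝕜)⁻¹) • N ^ (k + 1) := by
    rw [NormedSpace.exp_eq_tsum 𝕜]
    dsimp only
    rw [tsum_eq_sum (s := Finset.range (n + 1)), Finset.sum_range_succ']
    · simp
    · intro k hk
      have hk' : n < k := by simpa using hk
      rw [pow_eq_zero_of_le hk'.le hn, smul_zero]
  rw [h1]
  refine Commute.isNilpotent_sum (fun k _ => ?_) fun i j _ _ =>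
    (((Commute.refl N).pow_pow _ _).smul_left _).smul_right _
  refine IsNilpotent.smul ?_ _
  exact IsNilpotent.pow_succ k ⟨n, hn⟩

/-- A nilpotent endomorphism whose one-parameter group is semisimple near the identity is zero. -/
lemma eq_zero_of_isNilpotent_of_isSemisimple_exp {B : V →L[𝕜] V}
    (hB : IsNilpotent B) {δ : ℝ} (hδ : 0 < δ)
    (h : ∀ t : ℝ, |t| < δ → Module.End.IsSemisimple
      ((NormedSpace.exp ((t : 𝕜) • B) : V →L[𝕜] V) : V →ₗ[𝕜] V)) : B = 0 := by
  have : CompleteSpace V := FiniteDimensional.complete 𝕜 V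
  -- A unipotent semisimple operator is the identity; the derivative B at 0 then vanishes.
  have hexp : ∀ t : ℝ, |t| < δ → NormedSpace.exp ((t : 𝕜) • B) = 1 := by
    intro t ht
    have hnil : IsNilpotent (NormedSpace.exp ((t : 𝕜) • B) - 1) :=
      isNilpotent_exp_sub_one 𝕜 (hB.smul (t : 𝕜))
    have hss : Module.End.IsSemisimple
        (((NormedSpace.exp ((t : 𝕜) • B) - 1 : V →L[𝕜] V)) : V →ₗ[𝕜] V) :=
      (h t ht).sub_of_commute (Commute.one_right _) Module.End.isSemisimple_id
    have hnil' : IsNilpotent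
        (((NormedSpace.exp ((t : 𝕜) • B) - 1 : V →L[𝕜] V)) : Module.End 𝕜 V) :=
      hnil.map (ContinuousLinearMap.toLinearMapRingHom : (V →L[𝕜] V) →+* _)
    have h0 := Module.End.eq_zero_of_isNilpotent_isSemisimple hnil' hss
    exact sub_eq_zero.1 (ContinuousLinearMap.coe_injective h0)
  refine tendsto_nhds_unique ((hasDerivAt_exp_smul_zero (𝕜 := 𝕜) B).tendsto_inv_smul_sub δ hδ)
    (tendsto_const_nhds.congr fun n => ?_)
  have hlt : |δ / ((n : ℝ) + 2)| < δ := by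
    rw [abs_of_pos (by positivity)]
    exact div_lt_self hδ (by linarith [(Nat.cast_nonneg n : (0 : ℝ) ≤ n)])
  rw [hexp _ hlt]
  simp

end Exponential

/-! ### Averaging a hermitian form over a compact group. -/

section Haar

open Matrix MeasureTheory
open scoped ComplexOrder

/-- A continuous matrix representation of a compact group leaves a positive definite hermitian form
invariant. -/
lemma exists_posDef_invariant {𝕜 n K : Type*} [RCLike 𝕜] [Fintype n] [DecidableEq n]
    [Group K] [TopologicalSpace K] [IsTopologicalGroup K] [CompactSpace K]
    (ρ : K →* Matrix n n 𝕜) (hρ : Continuous ρ) :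
    ∃ P : Matrix n n 𝕜, P.PosDef ∧ ∀ k, (ρ k)ᴴ * P * ρ k = P := by
  let _ : MeasurableSpace K := borel K
  have : BorelSpace K := ⟨rfl⟩
  let μ : Measure K := Measure.haar
  -- With k⁻¹ in place of k, conjugating by ρ g amounts to a left translation of k, so left
  -- invariance of the Haar measure suffices.
  let f : K → Matrix n n 𝕜 := fun k => (ρ k⁻¹)ᴴ * ρ k⁻¹
  have hρi : Continuous fun k : K => ρ k⁻¹ := hρ.comp continuous_inv
  have hf : Continuous f := hρi.matrix_conjTranspose.matrix_mul hρi
  have hint : ∀ g : K → 𝕜, Continuous g → Integrable g μ := fun g hg =>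
    hg.integrable_of_hasCompactSupport (HasCompactSupport.of_compactSpace g)
  have hfi : ∀ i j, Integrable (fun k => f k i j) μ := fun i j => hint _ (hf.matrix_elem i j)
  let P : Matrix n n 𝕜 := Matrix.of fun i j => ∫ k, f k i j ∂μ
  have hlin : ∀ w v : n → 𝕜, w ⬝ᵥ P *ᵥ v = ∫ k, w ⬝ᵥ f k *ᵥ v ∂μ := by
    intro w v
    simp only [dotProduct, mulVec, P, Matrix.of_apply]
    rw [integral_finsetSum]
    · refine Finset.sum_congr rfl fun x _ => ?_
      rw [integral_const_mul, integral_finsetSum]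
      · simp_rw [integral_mul_const]
      · exact fun y _ => (hfi _ _).mul_const _
    · exact fun x _ => (integrable_finsetSum _ fun y _ => (hfi _ _).mul_const _).const_mul _
  refine ⟨P, Matrix.PosDef.of_dotProduct_mulVec_pos ?_ fun v hv => ?_, fun g => ?_⟩
  · ext i j
    simp only [conjTranspose_apply, P, Matrix.of_apply, RCLike.star_def]
    rw [← integral_conj]
    refine integral_congr_ae (.of_forall fun k => ?_)
    have : (f k)ᴴ = f k := by rw [conjTranspose_mul, conjTranspose_conjTranspose]
    exact congrFun (congrFun this i) j
  · let q : K → ℝ := fun k => ∑ i, ‖(ρ k⁻¹ *ᵥ v) i‖ ^ 2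
    have hq : ∀ k, star v ⬝ᵥ f k *ᵥ v = (q k : 𝕜) := by
      intro k
      rw [← mulVec_mulVec, dotProduct_mulVec, vecMul_conjTranspose, star_star]
      simp [dotProduct, q, RCLike.conj_mul]
    have hqc : Continuous q := by
      refine continuous_finsetSum _ fun i _ => ?_
      exact (((continuous_apply i).comp (hρi.matrix_mulVec continuous_const)).norm).pow 2
    simp_rw [hlin, hq]
    rw [integral_ofReal, RCLike.ofReal_pos]
    refine hqc.integral_pos_of_hasCompactSupport_nonneg_nonzero (x := 1)
      (HasCompactSupport.of_compactSpace _) (fun k => Finset.sum_nonneg fun i _ => by positivity) ?_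
    obtain ⟨i, hi⟩ := Function.ne_iff.1 hv
    refine (Finset.sum_pos' (fun i _ => by positivity) ⟨i, Finset.mem_univ i, ?_⟩).ne'
    have : 0 < ‖v i‖ := norm_pos_iff.2 hi
    simpa using pow_pos this 2
  · ext i j
    rw [Matrix.mul_mul_apply, hlin]
    simp_rw [← Matrix.mul_mul_apply]
    rw [← integral_mul_left_eq_self _ g]
    refine integral_congr_ae (.of_forall fun k => ?_)
    have : (ρ g)ᴴ * f (g * k) * ρ g = f k := by
      simp only [f]
      rw [← Matrix.mul_assoc, ← conjTranspose_mul, Matrix.mul_assoc, ← map_mul, _root_.mul_inv_rev,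
        inv_mul_cancel_right]
    simp only [this]

end Haar

/-! ### The differential of a representation as a Lie algebra homomorphism. -/

section LieGroup

open VectorField

variable {𝕜 : Type*} [RCLike 𝕜]
  {E : Type*} [NormedAddCommGroup E] [NormedSpace 𝕜 E]
  {G : Type*} [Group G] [TopologicalSpace G] [ChartedSpace E G]
  {V : Type*} [NormedAddCommGroup V] [NormedSpace 𝕜 V]

/-- A representation in the chart of the Lie group at the identity. -/
def chartRep (π : G →* (V →L[𝕜] V)) : E → (V →L[𝕜] V) :=
  π ∘ (extChartAt 𝓘(𝕜, E) (1 : G)).symm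

/-- The left invariant vector field of `X` in the chart at the identity. -/
noncomputable def chartField (X : GroupLieAlgebra 𝓘(𝕜, E) G) : E → E :=
  mpullbackWithin 𝓘(𝕜, E) 𝓘(𝕜, E) (extChartAt 𝓘(𝕜, E) (1 : G)).symm
    (mulInvariantVectorField X) (Set.range 𝓘(𝕜, E))

lemma contDiffOn_chartRep [IsManifold 𝓘(𝕜, E) ∞ G] {π : G →* (V →L[𝕜] V)}
    (hπ : ContMDiff 𝓘(𝕜, E) 𝓘(𝕜, V →L[𝕜] V) ∞ π) :
    ContDiffOn 𝕜 ∞ (chartRep (E := E) π) (extChartAt 𝓘(𝕜, E) (1 : G)).target :=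
  (hπ.comp_contMDiffOn (contMDiffOn_extChartAt_symm (n := ∞) (1 : G))).contDiffOn

lemma contDiffAt_chartRep [IsManifold 𝓘(𝕜, E) ∞ G] {π : G →* (V →L[𝕜] V)}
    (hπ : ContMDiff 𝓘(𝕜, E) 𝓘(𝕜, V →L[𝕜] V) ∞ π) {x : E}
    (hx : x ∈ (extChartAt 𝓘(𝕜, E) (1 : G)).target) :
    ContDiffAt 𝕜 ∞ (chartRep (E := E) π) x :=
  (contDiffOn_chartRep hπ).contDiffAt ((isOpen_extChartAt_target (1 : G)).mem_nhds hx)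

lemma chartRep_one (π : G →* (V →L[𝕜] V)) :
    chartRep (E := E) π (extChartAt 𝓘(𝕜, E) (1 : G) 1) = 1 := by
  simp [chartRep]

lemma repDeriv_apply_eq_fderiv {π : G →* (V →L[𝕜] V)}
    (hπ : ContMDiff 𝓘(𝕜, E) 𝓘(𝕜, V →L[𝕜] V) ∞ π) (X : GroupLieAlgebra 𝓘(𝕜, E) G) :
    repDeriv π X = fderiv 𝕜 (chartRep (E := E) π) (extChartAt 𝓘(𝕜, E) (1 : G) 1) X := by
  have h : MDifferentiableAt 𝓘(𝕜, E) 𝓘(𝕜, V →L[𝕜] V) π (1 : G) :=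
    hπ.mdifferentiableAt (by simp)
  change mfderiv 𝓘(𝕜, E) 𝓘(𝕜, V →L[𝕜] V) π (1 : G) X = _
  rw [h.mfderiv]
  simp only [modelWithCornersSelf_coe, Set.range_id, fderivWithin_univ]
  rfl

/-- Differentiate π(gx) = π(g)π(x) at x = 1. -/
lemma mfderiv_mulInvariantVectorField [LieGroup 𝓘(𝕜, E) ∞ G] {π : G →* (V →L[𝕜] V)}
    (hπ : ContMDiff 𝓘(𝕜, E) 𝓘(𝕜, V →L[𝕜] V) ∞ π) (X : GroupLieAlgebra 𝓘(𝕜, E) G) (g : G) :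
    mfderiv 𝓘(𝕜, E) 𝓘(𝕜, V →L[𝕜] V) π g (mulInvariantVectorField X g) = π g * repDeriv π X := by
  have hd : ∀ x, MDifferentiableAt 𝓘(𝕜, E) 𝓘(𝕜, V →L[𝕜] V) π x :=
    fun x => hπ.mdifferentiableAt (by simp)
  have hl : MDifferentiableAt 𝓘(𝕜, E) 𝓘(𝕜, E) (g * ·) (1 : G) :=
    (contMDiff_mul_left (n := ∞)).mdifferentiableAt (by simp)
  have h1 : mfderiv 𝓘(𝕜, E) 𝓘(𝕜, V →L[𝕜] V) (π ∘ (g * ·)) (1 : G) X =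
      mfderiv 𝓘(𝕜, E) 𝓘(𝕜, V →L[𝕜] V) π (g * 1) (mulInvariantVectorField X g) := by
    rw [mfderiv_comp (I' := 𝓘(𝕜, E)) _ (hd _) hl]
    rfl
  have h2 : π ∘ (g * ·) = (ContinuousLinearMap.mul 𝕜 (V →L[𝕜] V) (π g)) ∘ π := by
    ext x
    simp
  rw [h2, mfderiv_comp (I' := 𝓘(𝕜, V →L[𝕜] V)) _
    (ContinuousLinearMap.differentiableAt _).mdifferentiableAt (hd _), mfderiv_eq_fderiv,
    ContinuousLinearMap.fderiv, mul_one] at h1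
  exact h1.symm

/-- The left invariant differential equation in coordinates. It yields the bracket formula, the
regularity of the field, and the exponential form of its integral curves. -/
lemma fderiv_chartRep_chartField [LieGroup 𝓘(𝕜, E) ∞ G] {π : G →* (V →L[𝕜] V)}
    (hπ : ContMDiff 𝓘(𝕜, E) 𝓘(𝕜, V →L[𝕜] V) ∞ π) (X : GroupLieAlgebra 𝓘(𝕜, E) G) {x : E}
    (hx : x ∈ (extChartAt 𝓘(𝕜, E) (1 : G)).target) :
    fderiv 𝕜 (chartRep (E := E) π) x (chartField X x) = chartRep π x * repDeriv π X := by
  have : IsManifold 𝓘(𝕜, E) ∞ G := inferInstance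
  have : IsManifold 𝓘(𝕜, E) 1 G := IsManifold.of_le (n := ∞) (by simp)
  have hinv := isInvertible_mfderivWithin_extChartAt_symm (I := 𝓘(𝕜, E)) hx
  have hd : MDifferentiableAt 𝓘(𝕜, E) 𝓘(𝕜, V →L[𝕜] V) π
      ((extChartAt 𝓘(𝕜, E) (1 : G)).symm x) := hπ.mdifferentiableAt (by simp)
  rw [← mfderiv_eq_fderiv, ← mfderivWithin_univ, ← 𝓘(𝕜, E).range_eq_univ, chartRep,
    mfderiv_comp_mfderivWithin x hd (mdifferentiableWithinAt_extChartAt_symm hx)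
      (by rw [𝓘(𝕜, E).range_eq_univ]; exact uniqueMDiffWithinAt_univ _)]
  change mfderiv 𝓘(𝕜, E) 𝓘(𝕜, V →L[𝕜] V) π ((extChartAt 𝓘(𝕜, E) (1 : G)).symm x)
    (mfderivWithin 𝓘(𝕜, E) 𝓘(𝕜, E) (extChartAt 𝓘(𝕜, E) (1 : G)).symm (Set.range 𝓘(𝕜, E)) x
      (ContinuousLinearMap.inverse _ _)) = _
  rw [hinv.self_apply_inverse, mfderiv_mulInvariantVectorField hπ]
  rfl

/-- The differential of the chart is kept explicit because the manifold bracket is defined through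
its inverse. -/
lemma repDeriv_apply_eq_fderiv_mfderiv [IsManifold 𝓘(𝕜, E) ∞ G] {π : G →* (V →L[𝕜] V)}
    (hπ : ContMDiff 𝓘(𝕜, E) 𝓘(𝕜, V →L[𝕜] V) ∞ π) (X : GroupLieAlgebra 𝓘(𝕜, E) G) :
    repDeriv π X = fderiv 𝕜 (chartRep (E := E) π) (extChartAt 𝓘(𝕜, E) (1 : G) 1)
      (mfderiv 𝓘(𝕜, E) 𝓘(𝕜, E) (extChartAt 𝓘(𝕜, E) (1 : G)) 1 X) := by
  have : IsManifold 𝓘(𝕜, E) 1 G := IsManifold.of_le (n := ∞) (by simp)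
  have hp := (contDiffAt_chartRep hπ (mem_extChartAt_target (1 : G))).differentiableAt (by simp)
  have he : π =ᶠ[nhds (1 : G)] chartRep (E := E) π ∘ extChartAt 𝓘(𝕜, E) (1 : G) := by
    filter_upwards [extChartAt_source_mem_nhds (I := 𝓘(𝕜, E)) (1 : G)] with g hg
    simp only [chartRep, Function.comp_apply, (extChartAt 𝓘(𝕜, E) (1 : G)).left_inv hg]
  change mfderiv 𝓘(𝕜, E) 𝓘(𝕜, V →L[𝕜] V) π (1 : G) X = _
  rw [he.mfderiv_eq, mfderiv_comp (I' := 𝓘(𝕜, E)) _ hp.mdifferentiableAt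
    (mdifferentiableAt_extChartAt (mem_chart_source E (1 : G))), mfderiv_eq_fderiv]
  rfl

lemma differentiableAt_chartField [CompleteSpace E] [LieGroup 𝓘(𝕜, E) ∞ G]
    (X : GroupLieAlgebra 𝓘(𝕜, E) G) :
    DifferentiableAt 𝕜 (chartField X) (extChartAt 𝓘(𝕜, E) (1 : G) 1) := by
  have : LieGroup 𝓘(𝕜, E) (minSmoothness 𝕜 3) G := inferInstance
  have h := (mdifferentiableAt_mulInvariantVectorField X (g := 1)).mdifferentiableWithinAt
    (s := Set.univ) |>.differentiableWithinAt_mpullbackWithin_vectorField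
  rw [Set.preimage_univ, Set.univ_inter, 𝓘(𝕜, E).range_eq_univ] at h
  rw [chartField, 𝓘(𝕜, E).range_eq_univ]
  exact differentiableWithinAt_univ.1 h

/-- The differential of a representation is a homomorphism of Lie algebras. -/
lemma repDeriv_lie [CompleteSpace E] [LieGroup 𝓘(𝕜, E) ∞ G] {π : G →* (V →L[𝕜] V)}
    (hπ : ContMDiff 𝓘(𝕜, E) 𝓘(𝕜, V →L[𝕜] V) ∞ π) (X Y : GroupLieAlgebra 𝓘(𝕜, E) G) :
    repDeriv π ⁅X, Y⁆ = repDeriv π X * repDeriv π Y - repDeriv π Y * repDeriv π X := by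
  have : IsManifold 𝓘(𝕜, E) ∞ G := inferInstance
  have : IsManifold 𝓘(𝕜, E) 1 G := IsManifold.of_le (n := ∞) (by simp)
  set x₀ := extChartAt 𝓘(𝕜, E) (1 : G) 1 with hx₀
  have hmem : x₀ ∈ (extChartAt 𝓘(𝕜, E) (1 : G)).target := mem_extChartAt_target (1 : G)
  have hp : ContDiffAt 𝕜 ∞ (chartRep (E := E) π) x₀ := contDiffAt_chartRep hπ hmem
  have hp1 : DifferentiableAt 𝕜 (chartRep (E := E) π) x₀ := hp.differentiableAt (by simp)
  have hp2 : DifferentiableAt 𝕜 (fderiv 𝕜 (chartRep (E := E) π)) x₀ :=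
    (hp.fderiv_right (m := 1) (by norm_cast)).differentiableAt (by simp)
  have hsymm : IsSymmSndFDerivAt 𝕜 (chartRep (E := E) π) x₀ := hp.isSymmSndFDerivAt (by
    rw [minSmoothness_of_isRCLikeNormedField]
    exact ENat.LEInfty.out)
  -- Differentiate p'(Y) = p π'(Y) along X, where p is π in the chart. Exchanging X and Y and
  -- subtracting cancels the symmetric second derivative and leaves the bracket.
  have key : ∀ X Y : GroupLieAlgebra 𝓘(𝕜, E) G,
      fderiv 𝕜 (fderiv 𝕜 (chartRep (E := E) π)) x₀ (chartField X x₀) (chartField Y x₀) +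
        fderiv 𝕜 (chartRep (E := E) π) x₀ (fderiv 𝕜 (chartField Y) x₀ (chartField X x₀)) =
      repDeriv π X * repDeriv π Y := by
    intro X Y
    have he : (fun x => fderiv 𝕜 (chartRep (E := E) π) x (chartField Y x)) =ᶠ[nhds x₀]
        fun x => chartRep π x * repDeriv π Y := by
      filter_upwards [(isOpen_extChartAt_target (1 : G)).mem_nhds hmem] with x hx
      exact fderiv_chartRep_chartField hπ Y hx
    have h1 := he.fderiv_eq (𝕜 := 𝕜)
    rw [fderiv_clm_apply hp2 (differentiableAt_chartField Y), fderiv_mul_const' hp1] at h1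
    have h2 := DFunLike.congr_fun h1 (chartField X x₀)
    simp only [add_apply, ContinuousLinearMap.comp_apply,
      ContinuousLinearMap.flip_apply, smul_apply] at h2
    rw [fderiv_chartRep_chartField hπ X hmem, hx₀, chartRep_one, one_mul, ← hx₀] at h2
    rw [add_comm]
    exact h2
  have hinv := isInvertible_mfderiv_extChartAt (I := 𝓘(𝕜, E)) (mem_extChartAt_source (1 : G))
  have hbr : mfderiv 𝓘(𝕜, E) 𝓘(𝕜, E) (extChartAt 𝓘(𝕜, E) (1 : G)) 1 ⁅X, Y⁆ =
      lieBracket 𝕜 (chartField X) (chartField Y) x₀ := by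
    rw [GroupLieAlgebra.bracket_def, ← mlieBracketWithin_univ, mlieBracketWithin_apply]
    refine (hinv.self_apply_inverse _).trans ?_
    simp only [Set.preimage_univ, Set.univ_inter, 𝓘(𝕜, E).range_eq_univ, chartField]
    exact congrFun lieBracketWithin_univ x₀
  rw [repDeriv_apply_eq_fderiv_mfderiv hπ, hbr, lieBracket_eq]
  simp only [map_sub]
  rw [← key X Y, ← key Y X, hsymm.eq (chartField X x₀) (chartField Y x₀)]
  abel

end LieGroup

/-! ### A linear differential equation, and tangent vectors as limits of difference quotients. -/

section Calculus

/-- The solution of the linear differential equation `h' = h B`, `h 0 = 1`. -/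
lemma eq_exp_smul_of_hasDerivAt {𝔸 : Type*} [NormedRing 𝔸] [NormedAlgebra ℝ 𝔸] [CompleteSpace 𝔸]
    {h : ℝ → 𝔸} {B : 𝔸} {δ : ℝ} (h0 : h 0 = 1)
    (hd : ∀ t ∈ Set.Ioo (-δ) δ, HasDerivAt h (h t * B) t) {t : ℝ} (ht : t ∈ Set.Ioo (-δ) δ) :
    h t = NormedSpace.exp (t • B) := by
  let _ : NormedAlgebra ℚ 𝔸 := NormedAlgebra.restrictScalars ℚ ℝ 𝔸
  have hexp : ∀ s : ℝ, HasDerivAt (fun u : ℝ => NormedSpace.exp (-(u • B)))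
      (-(B * NormedSpace.exp (-(s • B)))) s := by
    intro s
    have := hasDerivAt_exp_smul_const' (-B) s
    simpa only [smul_neg, neg_mul] using this
  have hder : ∀ s ∈ Set.Ioo (-δ) δ,
      HasDerivAt (fun u => h u * NormedSpace.exp (-(u • B))) 0 s := by
    intro s hs
    have := (hd s hs).mul (hexp s)
    rwa [mul_neg, mul_assoc, add_neg_cancel] at this
  have h0mem : (0 : ℝ) ∈ Set.Ioo (-δ) δ := by
    have := ht.1.trans ht.2
    constructor <;> linarith
  have hconst := (convex_Ioo (-δ) δ).is_const_of_fderivWithin_eq_zero (𝕜 := ℝ)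
    (f := fun u => h u * NormedSpace.exp (-(u • B)))
    (fun s hs => (hder s hs).differentiableAt.differentiableWithinAt)
    (fun s hs => by
      rw [fderivWithin_of_isOpen isOpen_Ioo hs, (hder s hs).hasFDerivAt.fderiv]
      ext
      simp) ht h0mem
  simp only [h0, zero_smul, neg_zero, NormedSpace.exp_zero, mul_one] at hconst
  have hcomm : NormedSpace.exp (-(t • B)) * NormedSpace.exp (t • B) = 1 := by
    rw [← NormedSpace.exp_add_of_commute (Commute.neg_left (Commute.refl _)), neg_add_cancel,
      NormedSpace.exp_zero]
  calc h t = h t * (NormedSpace.exp (-(t • B)) * NormedSpace.exp (t • B)) := by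
        rw [hcomm, mul_one]
    _ = _ := by rw [← mul_assoc, hconst, one_mul]

/-- A limit of difference quotients along points converging to `y` lies in the range of the
derivative at `y`, if the latter is injective. -/
lemma mem_range_of_tendsto_smul_sub {𝕜 F W : Type*} [RCLike 𝕜] [NormedAddCommGroup F]
    [NormedSpace 𝕜 F] [FiniteDimensional 𝕜 F] [NormedAddCommGroup W] [NormedSpace 𝕜 W]
    {q : F → W} {L : F →L[𝕜] W} {y : F} (hq : HasFDerivAt q L y) (hL : Function.Injective L)
    {c : ℕ → F} (hc : Filter.Tendsto c Filter.atTop (nhds y)) {s : ℕ → 𝕜} {B : W}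
    (hB : Filter.Tendsto (fun n => s n • (q (c n) - q y)) Filter.atTop (nhds B)) :
    B ∈ LinearMap.range (L : F →ₗ[𝕜] W) := by
  have hind : Topology.IsInducing L :=
    (LinearMap.isClosedEmbedding_of_injective (f := L.toLinearMap)
      (LinearMap.ker_eq_bot.2 hL)).isInducing
  -- An injective L on a finite-dimensional space is bounded below, so the error of the linear
  -- approximation is negligible against q (c n) - q y itself, also after scaling by s n.
  have hO : (fun n => c n - y) =O[Filter.atTop] fun n => q (c n) - q y :=
    (hq.isTheta_sub hind).2.comp_tendsto hc
  have ho : (fun n => q (c n) - q y - L (c n - y)) =o[Filter.atTop] fun n => q (c n) - q y :=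
    (hq.isLittleO.comp_tendsto hc).trans_isBigO hO
  have ho' : (fun n => s n • (q (c n) - q y - L (c n - y))) =o[Filter.atTop]
      fun n => s n • (q (c n) - q y) :=
    (Asymptotics.isBigO_refl s _).smul_isLittleO ho
  have h0 : Filter.Tendsto (fun n => s n • (q (c n) - q y - L (c n - y))) Filter.atTop (nhds 0) :=
    (Asymptotics.isLittleO_one_iff ℝ).1 (ho'.trans_isBigO (hB.isBigO_one ℝ))
  have hlim : Filter.Tendsto (fun n => L (s n • (c n - y))) Filter.atTop (nhds B) := by
    have := hB.sub h0
    rw [sub_zero] at this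
    refine this.congr fun n => ?_
    rw [map_smul, ← smul_sub, sub_sub_cancel]
  have hcl : IsClosed (LinearMap.range (L : F →ₗ[𝕜] W) : Set W) :=
    Submodule.closed_of_finiteDimensional _
  exact hcl.mem_of_tendsto hlim (.of_forall fun n => ⟨_, rfl⟩)

end Calculus

/-! ### Local one-parameter groups, and why they stay in the centralizer. -/

section OneParameter

variable {𝕜 : Type*} [RCLike 𝕜]
  {E : Type*} [NormedAddCommGroup E] [NormedSpace 𝕜 E]
  {G : Type*} [Group G] [TopologicalSpace G] [ChartedSpace E G]
  {V : Type*} [NormedAddCommGroup V] [NormedSpace 𝕜 V]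

lemma injective_fderiv_chartRep {π : G →* (V →L[𝕜] V)}
    (hπ : ContMDiff 𝓘(𝕜, E) 𝓘(𝕜, V →L[𝕜] V) ∞ π)
    (hinj : Function.Injective (repDeriv (E := E) π)) :
    Function.Injective (fderiv 𝕜 (chartRep (E := E) π) (extChartAt 𝓘(𝕜, E) (1 : G) 1)) := by
  intro X Y h
  refine hinj ?_
  rw [repDeriv_apply_eq_fderiv hπ X, repDeriv_apply_eq_fderiv hπ Y]
  exact h

variable [FiniteDimensional 𝕜 E] [LieGroup 𝓘(𝕜, E) ∞ G]

/-- π is an immersion at 1, so near 1 the coordinates of g relative to 1 are bounded by a multiple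
of ‖π g - 1‖. -/
lemma eventually_eq_one_of_map_eq_one {π : G →* (V →L[𝕜] V)}
    (hπ : ContMDiff 𝓘(𝕜, E) 𝓘(𝕜, V →L[𝕜] V) ∞ π)
    (hinj : Function.Injective (repDeriv (E := E) π)) :
    ∀ᶠ g in nhds (1 : G), π g = 1 → g = 1 := by
  have hp := ((contDiffAt_chartRep hπ (mem_extChartAt_target (1 : G))).differentiableAt
    (by simp)).hasFDerivAt
  have hind : Topology.IsInducing (fderiv 𝕜 (chartRep (E := E) π)
      (extChartAt 𝓘(𝕜, E) (1 : G) 1)) :=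
    (LinearMap.isClosedEmbedding_of_injective (f := (fderiv 𝕜 (chartRep (E := E) π)
      (extChartAt 𝓘(𝕜, E) (1 : G) 1)).toLinearMap)
      (LinearMap.ker_eq_bot.2 (injective_fderiv_chartRep hπ hinj))).isInducing
  have hO := (hp.isTheta_sub hind).2.comp_tendsto
    (continuousAt_extChartAt (I := 𝓘(𝕜, E)) (1 : G))
  obtain ⟨C, hC⟩ := hO.bound
  filter_upwards [hC, extChartAt_source_mem_nhds (I := 𝓘(𝕜, E)) (1 : G)] with g hg hgs h1
  simp only [Function.comp_apply, chartRep_one] at hg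
  rw [chartRep, Function.comp_apply, (extChartAt 𝓘(𝕜, E) (1 : G)).left_inv hgs, h1, sub_self,
    norm_zero, mul_zero] at hg
  exact (extChartAt 𝓘(𝕜, E) (1 : G)).injOn hgs (mem_extChartAt_source (1 : G))
    (sub_eq_zero.1 (norm_le_zero_iff.1 hg))

lemma discreteTopology_ker [IsTopologicalGroup G] {π : G →* (V →L[𝕜] V)}
    (hπ : ContMDiff 𝓘(𝕜, E) 𝓘(𝕜, V →L[𝕜] V) ∞ π)
    (hinj : Function.Injective (repDeriv (E := E) π)) : DiscreteTopology π.ker := by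
  refine discreteTopology_of_isOpen_singleton_one ?_
  rw [isOpen_singleton_iff_nhds_eq_pure]
  refine le_antisymm (Filter.le_pure_iff.2 ?_) (pure_le_nhds _)
  have h := (continuous_subtype_val (p := fun g => g ∈ π.ker)).continuousAt (x := 1)
    |>.eventually (eventually_eq_one_of_map_eq_one hπ hinj)
  filter_upwards [h] with g hg
  exact Subtype.ext (hg g.2)

variable [FiniteDimensional 𝕜 V]

/-- Regularity for Picard–Lindelöf. A left inverse L of p' at the base point makes M = L p'
invertible nearby, and p'(field) = p π'(X) can be solved as field = M⁻¹ L(p π'(X)). -/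
lemma contDiffAt_chartField {π : G →* (V →L[𝕜] V)}
    (hπ : ContMDiff 𝓘(𝕜, E) 𝓘(𝕜, V →L[𝕜] V) ∞ π)
    (hinj : Function.Injective (repDeriv (E := E) π)) (X : GroupLieAlgebra 𝓘(𝕜, E) G) :
    ContDiffAt 𝕜 1 (chartField X) (extChartAt 𝓘(𝕜, E) (1 : G) 1) := by
  have : CompleteSpace E := FiniteDimensional.complete 𝕜 E
  set x₀ := extChartAt 𝓘(𝕜, E) (1 : G) 1 with hx₀
  have hmem : x₀ ∈ (extChartAt 𝓘(𝕜, E) (1 : G)).target := mem_extChartAt_target (1 : G)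
  have hp : ContDiffAt 𝕜 ∞ (chartRep (E := E) π) x₀ := contDiffAt_chartRep hπ hmem
  obtain ⟨L, hL⟩ := ContinuousLinearMap.HasLeftInverse.of_injective_of_finiteDimensional
    (injective_fderiv_chartRep hπ hinj)
  let M : E → (E →L[𝕜] E) := fun x => L.comp (fderiv 𝕜 (chartRep (E := E) π) x)
  have hM : ContDiffAt 𝕜 1 M x₀ := contDiffAt_const.clm_comp (hp.fderiv_right (by norm_cast))
  have hM₀ : M x₀ = (ContinuousLinearEquiv.refl 𝕜 E : E →L[𝕜] E) := by
    ext v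
    exact hL v
  have hMinv : ContDiffAt 𝕜 1 (fun x => (M x).inverse) x₀ := by
    have h := contDiffAt_map_inverse (n := 1) (ContinuousLinearEquiv.refl 𝕜 E)
    rw [← hM₀] at h
    exact h.comp x₀ hM
  have hright : ContDiffAt 𝕜 1 (fun x => L (chartRep (E := E) π x * repDeriv π X)) x₀ :=
    L.contDiff.contDiffAt.comp x₀ ((hp.of_le (by simp)).mul contDiffAt_const)
  refine (hMinv.clm_apply hright).congr_of_eventuallyEq ?_
  have hnhds : ∀ᶠ x in nhds x₀, M x ∈ Set.range ((↑) : (E ≃L[𝕜] E) → E →L[𝕜] E) := by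
    refine hM.continuousAt.eventually_mem ?_
    rw [hM₀]
    exact ContinuousLinearEquiv.nhds _
  filter_upwards [hnhds, (isOpen_extChartAt_target (1 : G)).mem_nhds hmem] with x hx hxt
  have hi : (M x).IsInvertible := hx
  rw [← fderiv_chartRep_chartField hπ X hxt]
  exact (hi.inverse_apply_self _).symm

/-- Locally, there is a continuous one-parameter subgroup in each direction. -/
lemma exists_curve {π : G →* (V →L[𝕜] V)}
    (hπ : ContMDiff 𝓘(𝕜, E) 𝓘(𝕜, V →L[𝕜] V) ∞ π)
    (hinj : Function.Injective (repDeriv (E := E) π)) (X : GroupLieAlgebra 𝓘(𝕜, E) G) :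
    ∃ δ > 0, ∃ γ : ℝ → G, γ 0 = 1 ∧ ContinuousOn γ (Set.Ioo (-δ) δ) ∧
      ∀ t ∈ Set.Ioo (-δ) δ, π (γ t) = NormedSpace.exp ((t : 𝕜) • repDeriv π X) := by
  have : CompleteSpace V := FiniteDimensional.complete 𝕜 V
  have : CompleteSpace E := FiniteDimensional.complete 𝕜 E
  let _ : NormedSpace ℝ E := NormedSpace.restrictScalars ℝ 𝕜 E
  let _ : NormedAlgebra ℝ (V →L[𝕜] V) := NormedAlgebra.restrictScalars ℝ 𝕜 (V →L[𝕜] V)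
  have : IsScalarTower ℝ 𝕜 E := RestrictScalars.isScalarTower ℝ 𝕜 E
  have : IsScalarTower ℝ 𝕜 (V →L[𝕜] V) := RestrictScalars.isScalarTower ℝ 𝕜 (V →L[𝕜] V)
  have hsmul : ∀ (t : ℝ) (B : V →L[𝕜] V), (t : 𝕜) • B = t • B := fun t B => algebraMap_smul 𝕜 t B
  set x₀ := extChartAt 𝓘(𝕜, E) (1 : G) 1 with hx₀
  have hmem : x₀ ∈ (extChartAt 𝓘(𝕜, E) (1 : G)).target := mem_extChartAt_target (1 : G)
  obtain ⟨α, hα0, ε, hε, hα⟩ := ((contDiffAt_chartField hπ hinj X).restrict_scalars ℝ)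
    |>.exists_forall_mem_closedBall_exists_eq_forall_mem_Ioo_hasDerivAt₀ 0
  simp only [zero_sub, zero_add] at hα
  have hαc : ContinuousAt α 0 := (hα 0 (by simpa using hε)).continuousAt
  obtain ⟨η, hη, hηt⟩ := Metric.mem_nhds_iff.1 (hαc.preimage_mem_nhds
    (by rw [hα0]; exact (isOpen_extChartAt_target (1 : G)).mem_nhds hmem))
  have hsub : ∀ t ∈ Set.Ioo (-min ε η) (min ε η), t ∈ Set.Ioo (-ε) ε ∧
      α t ∈ (extChartAt 𝓘(𝕜, E) (1 : G)).target := by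
    intro t ht
    have h1 := abs_lt.2 ht
    refine ⟨abs_lt.1 (h1.trans_le (min_le_left _ _)), hηt ?_⟩
    rw [mem_ball_zero_iff]
    exact h1.trans_le (min_le_right _ _)
  refine ⟨min ε η, lt_min hε hη, fun t => (extChartAt 𝓘(𝕜, E) (1 : G)).symm (α t), ?_, ?_, ?_⟩
  · simp [hα0]
  · exact (continuousOn_extChartAt_symm (1 : G)).comp
      (fun t ht => (hα t (hsub t ht).1).continuousAt.continuousWithinAt) fun t ht => (hsub t ht).2
  · intro t ht
    rw [hsmul]
    refine eq_exp_smul_of_hasDerivAt (h := fun t => chartRep (E := E) π (α t)) ?_ ?_ ht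
    · simp only [hα0, chartRep_one]
    · intro s hs
      have hd := ((contDiffAt_chartRep hπ (hsub s hs).2).differentiableAt
        (by simp)).hasFDerivAt.restrictScalars ℝ
      have := hd.comp_hasDerivAt s (hα s (hsub s hs).1)
      rw [← fderiv_chartRep_chartField hπ X (hsub s hs).2]
      exact this

/-- If `π' X` commutes with `π(A)`, then the local one-parameter subgroup in the direction `X` runs
in the connected centralizer of `A`. -/
lemma exists_curve_connectedCentralizer [IsTopologicalGroup G] {π : G →* (V →L[𝕜] V)}
    (hπ : ContMDiff 𝓘(𝕜, E) 𝓘(𝕜, V →L[𝕜] V) ∞ π)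
    (hinj : Function.Injective (repDeriv (E := E) π)) (A : Set G)
    (X : GroupLieAlgebra 𝓘(𝕜, E) G) (hX : ∀ a ∈ A, Commute (π a) (repDeriv π X)) :
    ∃ δ > (0 : ℝ), ∃ γ : Set.Ioo (-δ) δ → connectedCentralizer A, Continuous γ ∧
      (∀ t : Set.Ioo (-δ) δ, (t : ℝ) = 0 → γ t = 1) ∧
      ∀ t : Set.Ioo (-δ) δ, π (γ t) = NormedSpace.exp (((t : ℝ) : 𝕜) • repDeriv π X) := by
  have : CompleteSpace V := FiniteDimensional.complete 𝕜 V
  obtain ⟨δ, hδ, γ, hγ0, hγc, hγ⟩ := exists_curve hπ hinj X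
  have := discreteTopology_ker hπ hinj
  let zero : Set.Ioo (-δ) δ := ⟨0, by constructor <;> linarith⟩
  have hconn : PreconnectedSpace (Set.Ioo (-δ) δ) :=
    isPreconnected_iff_preconnectedSpace.1 isPreconnected_Ioo
  have hγc' : Continuous fun t : Set.Ioo (-δ) δ => γ t := continuousOn_iff_continuous_domRestrict.1 hγc
  have hcent : ∀ t : Set.Ioo (-δ) δ, γ t ∈ Subgroup.centralizer A := by
    intro t
    rw [Subgroup.mem_centralizer_iff]
    intro a ha
    -- This commutator varies continuously in a discrete group over a connected interval and equals
    -- 1 at s = 0, so it is always 1.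
    have hker : ∀ s : Set.Ioo (-δ) δ, (γ s)⁻¹ * (a * γ s * a⁻¹) ∈ π.ker := by
      intro s
      have hcomm : Commute (π a) (π (γ s)) := by
        rw [hγ s s.2]
        exact ((hX a ha).smul_right _).exp_right
      rw [MonoidHom.mem_ker, map_mul, map_mul, map_mul, hcomm.eq, mul_assoc (π (γ s)), ← map_mul,
        mul_inv_cancel, map_one, mul_one, ← map_mul, inv_mul_cancel, map_one]
    have hf : Continuous fun s : Set.Ioo (-δ) δ =>
        (⟨(γ s)⁻¹ * (a * γ s * a⁻¹), hker s⟩ : π.ker) :=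
      (hγc'.inv.mul ((continuous_const.mul hγc').mul continuous_const)).subtype_mk _
    have h := congrArg Subtype.val (PreconnectedSpace.constant hconn hf (x := t) (y := zero))
    simp only [zero, hγ0, inv_one, mul_one, mul_inv_cancel] at h
    rw [inv_mul_eq_one] at h
    rw [eq_mul_inv_iff_mul_eq] at h
    exact h.symm
  let c : Set.Ioo (-δ) δ → Subgroup.centralizer A := fun t => ⟨γ t, hcent t⟩
  have hc : Continuous c := hγc'.subtype_mk _
  have hcomp : ∀ t, c t ∈ Subgroup.connectedComponentOfOne (Subgroup.centralizer A) := fun t =>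
    (isPreconnected_range hc).subset_connectedComponent
      ⟨zero, Subtype.ext hγ0⟩ ⟨t, rfl⟩
  refine ⟨δ, hδ, fun t => ⟨γ t, c t, hcomp t, rfl⟩, hγc'.subtype_mk _, fun t ht => ?_,
    fun t => hγ t t.2⟩
  ext
  simp [ht, hγ0]

end OneParameter

/-! ### Injectivity of the differential of an immersion. -/

section Immersion

/-- The differential of an immersion is injective. -/
lemma Manifold.IsImmersionAt.injective_mfderiv {𝕜 : Type*} [NontriviallyNormedField 𝕜]
    {E F : Type*} [NormedAddCommGroup E] [NormedSpace 𝕜 E] [NormedAddCommGroup F] [NormedSpace 𝕜 F]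
    {M N : Type*} [TopologicalSpace M] [ChartedSpace F M] [TopologicalSpace N] [ChartedSpace E N]
    [IsManifold 𝓘(𝕜, F) ∞ M] [IsManifold 𝓘(𝕜, E) ∞ N]
    {f : M → N} {x : M} (h : IsImmersionAt 𝓘(𝕜, F) 𝓘(𝕜, E) ∞ f x) :
    Function.Injective (mfderiv 𝓘(𝕜, F) 𝓘(𝕜, E) f x) := by
  -- A local left inverse of f: project onto the first factor in the normal form of the immersion.
  let r : N → M := fun y => h.domChart.symm (h.equiv.symm (h.codChart y)).1
  have hval : ∀ y ∈ h.domChart.source, (h.equiv.symm (h.codChart (f y))).1 = h.domChart y := by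
    intro y hy
    have hmem : h.domChart y ∈ (h.domChart.extend 𝓘(𝕜, F)).target := by
      simpa [OpenPartialHomeomorph.extend_target] using h.domChart.map_source hy
    have hw := h.writtenInCharts hmem
    simp only [Function.comp_apply, OpenPartialHomeomorph.extend_coe,
      OpenPartialHomeomorph.extend_coe_symm, modelWithCornersSelf_coe,
      modelWithCornersSelf_coe_symm, id, h.domChart.left_inv hy] at hw
    rw [hw, ContinuousLinearEquiv.symm_apply_apply]
  have hrf : r ∘ f =ᶠ[nhds x] id := by
    filter_upwards [h.domChart.open_source.mem_nhds h.mem_domChart_source] with y hy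
    simp only [Function.comp_apply, r, hval y hy, id, h.domChart.left_inv hy]
  have hfx := h.mem_codChart_source
  have hx := h.mem_domChart_source
  have hd1 : MDifferentiableAt 𝓘(𝕜, E) 𝓘(𝕜, F)
      (fun y => (h.equiv.symm (h.codChart y)).1) (f x) := by
    have h1 : MDifferentiableAt 𝓘(𝕜, E) 𝓘(𝕜, E) h.codChart (f x) :=
      ((contMDiffOn_of_mem_maximalAtlas h.codChart_mem_maximalAtlas).mdifferentiableOn
        (by simp)).mdifferentiableAt (h.codChart.open_source.mem_nhds hfx)
    have h2 : DifferentiableAt 𝕜 (fun z : E => (h.equiv.symm z).1) (h.codChart (f x)) :=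
      ((ContinuousLinearMap.fst 𝕜 F h.complement).comp
        (h.equiv.symm : E →L[𝕜] F × h.complement)).differentiableAt
    exact h2.mdifferentiableAt.comp (f x) h1
  have hr : MDifferentiableAt 𝓘(𝕜, E) 𝓘(𝕜, F) r (f x) := by
    have h1 : MDifferentiableAt 𝓘(𝕜, F) 𝓘(𝕜, F) h.domChart.symm
        (h.equiv.symm (h.codChart (f x))).1 := by
      refine ((contMDiffOn_symm_of_mem_maximalAtlas
        h.domChart_mem_maximalAtlas).mdifferentiableOn (by simp)).mdifferentiableAt
          (h.domChart.open_target.mem_nhds ?_)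
      rw [hval x hx]
      exact h.domChart.map_source hx
    exact h1.comp (f x) hd1
  have hf : MDifferentiableAt 𝓘(𝕜, F) 𝓘(𝕜, E) f x := h.contMDiffAt.mdifferentiableAt (by simp)
  have hcomp := mfderiv_comp x hr hf
  rw [hrf.mfderiv_eq, mfderiv_id] at hcomp
  intro v w hvw
  have h1 := DFunLike.congr_fun hcomp v
  have h2 := DFunLike.congr_fun hcomp w
  have h3 : (mfderiv 𝓘(𝕜, E) 𝓘(𝕜, F) r (f x)) (mfderiv 𝓘(𝕜, F) 𝓘(𝕜, E) f x v) =
      (mfderiv 𝓘(𝕜, E) 𝓘(𝕜, F) r (f x)) (mfderiv 𝓘(𝕜, F) 𝓘(𝕜, E) f x w) := congrArg _ hvw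
  exact h1.trans (h3.trans h2.symm)

end Immersion

/-! ### Conjugation, and commutants of the group and of its Lie algebra. -/

section Representations

variable {𝕜 : Type*} [RCLike 𝕜]
  {E : Type*} [NormedAddCommGroup E] [NormedSpace 𝕜 E]
  {G : Type*} [Group G] [TopologicalSpace G] [ChartedSpace E G] [LieGroup 𝓘(𝕜, E) ∞ G]
  {V : Type*} [NormedAddCommGroup V] [NormedSpace 𝕜 V]

/-- The image of the Lie algebra is stable under conjugation by the image of the group. -/
lemma exists_repDeriv_eq_conj {π : G →* (V →L[𝕜] V)}
    (hπ : ContMDiff 𝓘(𝕜, E) 𝓘(𝕜, V →L[𝕜] V) ∞ π) (a : G) (X : GroupLieAlgebra 𝓘(𝕜, E) G) :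
    ∃ Y : GroupLieAlgebra 𝓘(𝕜, E) G, repDeriv π Y = π a * repDeriv π X * π a⁻¹ := by
  have hd : ∀ x, MDifferentiableAt 𝓘(𝕜, E) 𝓘(𝕜, V →L[𝕜] V) π x :=
    fun x => hπ.mdifferentiableAt (by simp)
  have hc : MDifferentiableAt 𝓘(𝕜, E) 𝓘(𝕜, E) (fun g : G => a * g * a⁻¹) (1 : G) :=
    ((contMDiff_mul_right (n := ∞) (a := a⁻¹)).comp
      (contMDiff_mul_left (n := ∞) (a := a))).mdifferentiableAt (by simp)
  -- The witness is Ad(a) X.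
  refine ⟨mfderiv 𝓘(𝕜, E) 𝓘(𝕜, E) (fun g : G => a * g * a⁻¹) (1 : G) X, ?_⟩
  have h1 := mfderiv_comp_of_eq (I' := 𝓘(𝕜, E)) (y := (1 : G)) (hd 1) hc (by simp)
  have h2 : π ∘ (fun g : G => a * g * a⁻¹) =
      (ContinuousLinearMap.mulLeftRight 𝕜 (V →L[𝕜] V) (π a) (π a⁻¹)) ∘ π := by
    ext x
    simp
  rw [h2, mfderiv_comp (I' := 𝓘(𝕜, V →L[𝕜] V)) _
    (ContinuousLinearMap.differentiableAt _).mdifferentiableAt (hd _), mfderiv_eq_fderiv,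
    ContinuousLinearMap.fderiv] at h1
  have h3 : ∀ (y : G) (v : E), y = 1 →
      (mfderiv 𝓘(𝕜, E) 𝓘(𝕜, V →L[𝕜] V) π y : E →L[𝕜] (V →L[𝕜] V)) v = repDeriv (E := E) π v := by
    rintro _ v rfl
    rfl
  exact (h3 _ _ (by simp)).symm.trans (DFunLike.congr_fun h1 X).symm

/-- What commutes with the image of the group commutes with the image of the Lie algebra. -/
lemma commute_repDeriv {π : G →* (V →L[𝕜] V)}
    (hπ : ContMDiff 𝓘(𝕜, E) 𝓘(𝕜, V →L[𝕜] V) ∞ π) {C : V →L[𝕜] V} (hC : ∀ g, Commute C (π g))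
    (X : GroupLieAlgebra 𝓘(𝕜, E) G) : Commute C (repDeriv π X) := by
  have hp := (contDiffAt_chartRep hπ (mem_extChartAt_target (1 : G))).differentiableAt
    (by simp)
  let L : (V →L[𝕜] V) →L[𝕜] (V →L[𝕜] V) :=
    ContinuousLinearMap.mul 𝕜 (V →L[𝕜] V) C - (ContinuousLinearMap.mul 𝕜 (V →L[𝕜] V)).flip C
  have h : (fun x => L (chartRep (E := E) π x)) = fun _ => 0 :=
    funext fun x => sub_eq_zero.2 (hC _)
  have h1 := L.hasFDerivAt.comp (extChartAt 𝓘(𝕜, E) (1 : G) 1) hp.hasFDerivAt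
  have h2 := h1.unique (by rw [Function.comp_def, h]; exact hasFDerivAt_const _ _)
  rw [repDeriv_apply_eq_fderiv hπ X]
  exact sub_eq_zero.1 (DFunLike.congr_fun h2 X)

/-- At 1 the derivative in direction X is the commutator of π'(X) and B, which is zero. Left
translation by g multiplies the function by π(g) and π(g⁻¹) on the two sides, which carries this to
every point. -/
lemma hasMFDerivAt_conj {π : G →* (V →L[𝕜] V)}
    (hπ : ContMDiff 𝓘(𝕜, E) 𝓘(𝕜, V →L[𝕜] V) ∞ π) {B : V →L[𝕜] V}
    (hB : ∀ X : GroupLieAlgebra 𝓘(𝕜, E) G, Commute B (repDeriv π X)) (g : G) :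
    HasMFDerivAt 𝓘(𝕜, E) 𝓘(𝕜, V →L[𝕜] V) (fun h => π h * B * π h⁻¹) g 0 := by
  have hπi : ContMDiff 𝓘(𝕜, E) 𝓘(𝕜, V →L[𝕜] V) ∞ fun h => π h⁻¹ :=
    hπ.comp (contMDiff_inv 𝓘(𝕜, E) ∞)
  have ha : HasMFDerivAt 𝓘(𝕜, E) 𝓘(𝕜, V →L[𝕜] V) π (1 : G) _ :=
    (hπ.mdifferentiableAt (by simp)).hasMFDerivAt
  have hb : HasMFDerivAt 𝓘(𝕜, E) 𝓘(𝕜, V →L[𝕜] V) (fun h : G => π h⁻¹) (1 : G) _ :=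
    (hπi.mdifferentiableAt (by simp)).hasMFDerivAt
  have hBc : HasMFDerivAt 𝓘(𝕜, E) 𝓘(𝕜, V →L[𝕜] V) (fun _ : G => B) (1 : G) _ :=
    hasMFDerivAt_const B 1
  have hprod : (π : G → (V →L[𝕜] V)) * (fun h : G => π h⁻¹) = fun _ => 1 := by
    ext1 h
    rw [Pi.mul_apply, ← map_mul, mul_inv_cancel, map_one]
  have hab := ha.mul' hb
  rw [hprod] at hab
  have hab0 := hasMFDerivAt_unique hab (hasMFDerivAt_const 1 1)
  have h1 : HasMFDerivAt 𝓘(𝕜, E) 𝓘(𝕜, V →L[𝕜] V) (fun h => π h * B * π h⁻¹) (1 : G) 0 := by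
    have := (ha.mul' hBc).mul' hb
    refine this.congr_mfderiv (ContinuousLinearMap.ext fun X => ?_)
    have hX := DFunLike.congr_fun hab0 X
    have hBX := hB X
    set u : V →L[𝕜] V := mfderiv 𝓘(𝕜, E) 𝓘(𝕜, V →L[𝕜] V) π (1 : G) X with hu
    set v : V →L[𝕜] V := mfderiv 𝓘(𝕜, E) 𝓘(𝕜, V →L[𝕜] V) (fun h : G => π h⁻¹) (1 : G) X with hv
    change π 1 * v + u * π 1⁻¹ = 0 at hX
    change π 1 * B * v + (π 1 * 0 + u * B) * π 1⁻¹ = 0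
    change B * u = u * B at hBX
    rw [inv_one, map_one, one_mul, mul_one] at hX
    rw [inv_one, map_one, one_mul, mul_one, mul_zero, zero_add, eq_neg_of_add_eq_zero_left hX,
      mul_neg, hBX, neg_add_cancel]
  have hl : MDifferentiableAt 𝓘(𝕜, E) 𝓘(𝕜, E) (g⁻¹ * ·) g :=
    (contMDiff_mul_left (n := ∞)).mdifferentiableAt (by simp)
  rw [← inv_mul_cancel g] at h1
  have h2 := h1.comp g hl.hasMFDerivAt
  have h3 := ((ContinuousLinearMap.mulLeftRight 𝕜 (V →L[𝕜] V) (π g) (π g⁻¹)).hasMFDerivAt).comp g h2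
  have hfun : (fun h => π h * B * π h⁻¹) = (ContinuousLinearMap.mulLeftRight 𝕜 (V →L[𝕜] V) (π g)
      (π g⁻¹)) ∘ (fun h => π h * B * π h⁻¹) ∘ (g⁻¹ * ·) := by
    ext1 h
    simp only [Function.comp_apply, ContinuousLinearMap.mulLeftRight_apply]
    have e1 : π h = π g * π (g⁻¹ * h) := by rw [← map_mul, mul_inv_cancel_left]
    have e2 : π h⁻¹ = π (g⁻¹ * h)⁻¹ * π g⁻¹ := by rw [← map_mul]; simp
    rw [e1, e2]
    simp only [mul_assoc]
  rw [hfun]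
  refine h3.congr_mfderiv (ContinuousLinearMap.ext fun X => ?_)
  exact map_zero (ContinuousLinearMap.mulLeftRight 𝕜 (V →L[𝕜] V) (π g) (π g⁻¹))

/-- In a connected Lie group, what commutes with the image of the Lie algebra commutes with the
image of the group. -/
lemma commute_of_commute_repDeriv [IsTopologicalGroup G] [PreconnectedSpace G]
    {π : G →* (V →L[𝕜] V)}
    (hπ : ContMDiff 𝓘(𝕜, E) 𝓘(𝕜, V →L[𝕜] V) ∞ π) {B : V →L[𝕜] V}
    (hB : ∀ X : GroupLieAlgebra 𝓘(𝕜, E) G, Commute B (repDeriv π X)) (g : G) :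
    Commute B (π g) := by
  let _ : NormedSpace ℝ E := NormedSpace.restrictScalars ℝ 𝕜 E
  obtain ⟨ε, hε, hball⟩ := Metric.mem_nhds_iff.1
    ((isOpen_extChartAt_target (I := 𝓘(𝕜, E)) (1 : G)).mem_nhds (mem_extChartAt_target (1 : G)))
  set x₀ := extChartAt 𝓘(𝕜, E) (1 : G) 1 with hx₀
  have hder : ∀ x ∈ Metric.ball x₀ ε, HasFDerivAt
      (fun x => π ((extChartAt 𝓘(𝕜, E) (1 : G)).symm x) * B *
        π ((extChartAt 𝓘(𝕜, E) (1 : G)).symm x)⁻¹) (0 : E →L[𝕜] (V →L[𝕜] V)) x := by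
    intro x hx
    have hs : MDifferentiableAt 𝓘(𝕜, E) 𝓘(𝕜, E) (extChartAt 𝓘(𝕜, E) (1 : G)).symm x :=
      ((contMDiffOn_extChartAt_symm (n := ∞) (1 : G)).mdifferentiableOn
        (by simp)).mdifferentiableAt ((isOpen_extChartAt_target (1 : G)).mem_nhds (hball hx))
    have h := (hasMFDerivAt_conj hπ hB ((extChartAt 𝓘(𝕜, E) (1 : G)).symm x)).comp x hs.hasMFDerivAt
    rw [ContinuousLinearMap.zero_comp] at h
    exact h.hasFDerivAt
  have hconst : ∀ x ∈ Metric.ball x₀ ε, π ((extChartAt 𝓘(𝕜, E) (1 : G)).symm x) * B *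
        π ((extChartAt 𝓘(𝕜, E) (1 : G)).symm x)⁻¹ = B := by
    intro x hx
    have h := (convex_ball x₀ ε).is_const_of_fderivWithin_eq_zero (𝕜 := 𝕜)
      (fun y hy => (hder y hy).differentiableAt.differentiableWithinAt)
      (fun y hy => by
        rw [fderivWithin_of_isOpen Metric.isOpen_ball hy, (hder y hy).fderiv])
      hx (Metric.mem_ball_self hε)
    rw [h, hx₀, extChartAt_to_inv]
    simp
  -- The commutation subgroup contains a neighbourhood of 1, hence is open and closed, hence
  -- everything.
  let S : Subgroup G :=
    { carrier := {h | Commute B (π h)}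
      mul_mem' := fun {a b} ha hb => by
        rw [Set.mem_ofPred_eq, map_mul]
        exact ha.mul_right hb
      one_mem' := by
        rw [Set.mem_ofPred_eq, map_one]
        exact Commute.one_right B
      inv_mem' := fun {a} ha => by
        have hu : π a * π a⁻¹ = 1 := by rw [← map_mul, mul_inv_cancel, map_one]
        have hu' : π a⁻¹ * π a = 1 := by rw [← map_mul, inv_mul_cancel, map_one]
        exact Commute.units_inv_right (u := ⟨π a, π a⁻¹, hu, hu'⟩) ha }
  have hS : IsOpen (S : Set G) := by
    refine S.isOpen_of_mem_nhds (g := 1) ?_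
    filter_upwards [(continuousAt_extChartAt (I := 𝓘(𝕜, E)) (1 : G)).preimage_mem_nhds
      (Metric.ball_mem_nhds _ hε), extChartAt_source_mem_nhds (I := 𝓘(𝕜, E)) (1 : G)] with h hh hhs
    have h1 := hconst _ hh
    rw [(extChartAt 𝓘(𝕜, E) (1 : G)).left_inv hhs] at h1
    have h2 : π h⁻¹ * π h = 1 := by rw [← map_mul, inv_mul_cancel, map_one]
    change B * π h = π h * B
    nth_rw 1 [← h1]
    rw [mul_assoc, h2, mul_one]
  have huniv : (S : Set G) = Set.univ :=
    IsClopen.eq_univ ⟨S.isClosed_of_isOpen hS, hS⟩ ⟨1, S.one_mem⟩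
  have hg : g ∈ (S : Set G) := huniv ▸ Set.mem_univ g
  exact hg

end Representations

/-! ### Symmetry and cyclicity of the trace form. -/

section TraceForm

variable {𝕜 : Type*} [RCLike 𝕜] {V : Type*} [NormedAddCommGroup V] [NormedSpace 𝕜 V]

lemma endTraceForm_apply (S T : V →L[𝕜] V) : endTraceForm 𝕜 V S T =
    LinearMap.trace 𝕜 V ((S * T : V →L[𝕜] V) : V →ₗ[𝕜] V) := rfl

lemma endTraceForm_comm (S T : V →L[𝕜] V) : endTraceForm 𝕜 V S T = endTraceForm 𝕜 V T S :=
  LinearMap.trace_mul_comm 𝕜 (S : Module.End 𝕜 V) (T : Module.End 𝕜 V)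

lemma endTraceForm_mul_left (S T U : V →L[𝕜] V) :
    endTraceForm 𝕜 V (S * T) U = endTraceForm 𝕜 V S (T * U) := by
  rw [endTraceForm_apply, endTraceForm_apply, mul_assoc]

lemma endTraceForm_mul_right (S T U : V →L[𝕜] V) :
    endTraceForm 𝕜 V S (T * U) = endTraceForm 𝕜 V (U * S) T := by
  rw [endTraceForm_comm, endTraceForm_mul_left, endTraceForm_comm]

end TraceForm

/-! ### The orthogonal projection and its equivariance. -/

section Projection

variable {𝕜 : Type*} [RCLike 𝕜]
  {E : Type*} [NormedAddCommGroup E] [NormedSpace 𝕜 E]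
  {G : Type*} [Group G] [TopologicalSpace G] [ChartedSpace E G]
  {V : Type*} [NormedAddCommGroup V] [NormedSpace 𝕜 V] [FiniteDimensional 𝕜 V]

lemma endTraceForm_sub_cayleyProj {π : G →* (V →L[𝕜] V)} (hπ : AdmitsCayley (E := E) π)
    (W : V →L[𝕜] V) (X : GroupLieAlgebra 𝓘(𝕜, E) G) :
    endTraceForm 𝕜 V (repDeriv π X) (W - cayleyProj π hπ W) = 0 := by
  have hker : cayleyProj π hπ (W - cayleyProj π hπ W) = 0 := by
    rw [map_sub, sub_eq_zero]
    exact (Submodule.projectionOnto_apply_left _ _).symm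
  exact (Submodule.projectionOnto_apply_eq_zero_iff _).1 hker _ ⟨X, rfl⟩

/-- The projection is determined by orthogonality. -/
lemma cayleyProj_eq_of_forall {π : G →* (V →L[𝕜] V)} (hπ : AdmitsCayley (E := E) π)
    {W P : V →L[𝕜] V} (hP : P ∈ LinearMap.range (repDeriv (E := E) π))
    (h : ∀ X : GroupLieAlgebra 𝓘(𝕜, E) G, endTraceForm 𝕜 V (repDeriv π X) (W - P) = 0) :
    (cayleyProj π hπ W : V →L[𝕜] V) = P := by
  have hker : cayleyProj π hπ (W - P) = 0 := by
    refine (Submodule.projectionOnto_apply_eq_zero_iff _).2 ?_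
    rintro _ ⟨X, rfl⟩
    exact h X
  rw [map_sub, sub_eq_zero] at hker
  rw [hker]
  exact congrArg Subtype.val (Submodule.projectionOnto_apply_left _ (⟨P, hP⟩ :
    LinearMap.range (repDeriv (E := E) π)))

lemma repDeriv_cayleyMap {π : G →* (V →L[𝕜] V)} (hπ : AdmitsCayley (E := E) π) (g : G) :
    repDeriv π (cayleyMap π hπ g) = cayleyProj π hπ (π g) :=
  congrArg Subtype.val
    ((LinearEquiv.ofInjective (repDeriv (E := E) π) hπ.injective).apply_symm_apply _)

/-- The projection is equivariant under conjugation. -/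
lemma commute_cayleyProj [LieGroup 𝓘(𝕜, E) ∞ G] {π : G →* (V →L[𝕜] V)}
    (hsmooth : ContMDiff 𝓘(𝕜, E) 𝓘(𝕜, V →L[𝕜] V) ∞ π) (hπ : AdmitsCayley (E := E) π)
    {a : G} {W : V →L[𝕜] V} (hW : Commute (π a) W) :
    Commute (π a) (cayleyProj π hπ W : V →L[𝕜] V) := by
  have h1 : π a * π a⁻¹ = 1 := by rw [← map_mul, mul_inv_cancel, map_one]
  have h2 : π a⁻¹ * π a = 1 := by rw [← map_mul, inv_mul_cancel, map_one]
  obtain ⟨X, hX⟩ := (cayleyProj π hπ W).2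
  obtain ⟨Y, hY⟩ := exists_repDeriv_eq_conj hsmooth a X
  rw [hX] at hY
  -- The conjugate has the two properties that determine the projection; for orthogonality,
  -- cyclicity of the trace moves the conjugation onto π'(Z).
  have key : (cayleyProj π hπ W : V →L[𝕜] V) = π a * cayleyProj π hπ W * π a⁻¹ := by
    refine cayleyProj_eq_of_forall hπ ⟨Y, hY⟩ fun Z => ?_
    have hconj : W - π a * cayleyProj π hπ W * π a⁻¹ =
        π a * ((W - cayleyProj π hπ W) * π a⁻¹) := by
      rw [sub_mul, mul_sub, ← mul_assoc, ← mul_assoc, hW.eq, mul_assoc W, h1, mul_one]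
    obtain ⟨Z', hZ'⟩ := exists_repDeriv_eq_conj hsmooth a⁻¹ Z
    rw [hconj, ← endTraceForm_mul_left, endTraceForm_mul_right, ← mul_assoc]
    rw [inv_inv] at hZ'
    rw [← hZ', endTraceForm_sub_cayleyProj]
  change π a * cayleyProj π hπ W = cayleyProj π hπ W * π a
  nth_rw 2 [key]
  rw [mul_assoc _ (π a⁻¹), h2, mul_one]

omit [FiniteDimensional 𝕜 V] in
lemma nondegenerate_restrict_of_forall {π : G →* (V →L[𝕜] V)}
    (h : ∀ X : GroupLieAlgebra 𝓘(𝕜, E) G, (∀ Y : GroupLieAlgebra 𝓘(𝕜, E) G,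
      endTraceForm 𝕜 V (repDeriv π X) (repDeriv π Y) = 0) → repDeriv π X = 0) :
    ((endTraceForm 𝕜 V).restrict (LinearMap.range (repDeriv (E := E) π))).Nondegenerate := by
  constructor
  · rintro ⟨_, X, rfl⟩ hX
    exact Subtype.ext (h X fun Y => hX ⟨_, Y, rfl⟩)
  · rintro ⟨_, X, rfl⟩ hX
    exact Subtype.ext (h X fun Y => (endTraceForm_comm _ _).trans (hX ⟨_, Y, rfl⟩))

end Projection

/-! ### The Lie algebra of the connected centralizer. -/

section Subgroup

variable {𝕜 : Type*} [RCLike 𝕜]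
  {E : Type*} [NormedAddCommGroup E] [NormedSpace 𝕜 E]
  {G : Type*} [Group G] [TopologicalSpace G] [ChartedSpace E G]
  {V : Type*} [NormedAddCommGroup V] [NormedSpace 𝕜 V]

/-- The chain rule; it places σ'(𝔥) inside π'(𝔤). -/
lemma repDeriv_comp_subtype {F : Type*} [NormedAddCommGroup F] [NormedSpace 𝕜 F] {H : Subgroup G}
    [ChartedSpace F H] {π : G →* (V →L[𝕜] V)}
    (hπ : ContMDiff 𝓘(𝕜, E) 𝓘(𝕜, V →L[𝕜] V) ∞ π)
    (hι : ContMDiff 𝓘(𝕜, F) 𝓘(𝕜, E) ∞ (Subtype.val : H → G)) (Y : GroupLieAlgebra 𝓘(𝕜, F) H) :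
    repDeriv (π.comp H.subtype) Y =
      repDeriv (E := E) π (mfderiv 𝓘(𝕜, F) 𝓘(𝕜, E) (Subtype.val : H → G) 1 Y) := by
  have h := mfderiv_comp (I' := 𝓘(𝕜, E)) (1 : H)
    (hπ.mdifferentiableAt (x := ((1 : H) : G)) (by simp)) (hι.mdifferentiableAt (by simp))
  exact DFunLike.congr_fun h Y

instance connectedSpace_connectedCentralizer [IsTopologicalGroup G] (A : Set G) :
    ConnectedSpace (connectedCentralizer A) := by
  have h : IsConnected (connectedComponent (1 : Subgroup.centralizer A)) :=
    isConnected_connectedComponent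
  exact isConnected_iff_connectedSpace.1 (h.image _ continuous_subtype_val.continuousOn)

/-- An element of the Lie algebra whose image commutes with `π(A)` lies in the Lie algebra of the
connected centralizer of `A`. -/
lemma mem_range_repDeriv_of_commute [FiniteDimensional 𝕜 E] [LieGroup 𝓘(𝕜, E) ∞ G]
    [FiniteDimensional 𝕜 V] [IsTopologicalGroup G] {π : G →* (V →L[𝕜] V)}
    (hπ : ContMDiff 𝓘(𝕜, E) 𝓘(𝕜, V →L[𝕜] V) ∞ π)
    (hinj : Function.Injective (repDeriv (E := E) π)) {A : Set G}
    {F : Type*} [NormedAddCommGroup F] [NormedSpace 𝕜 F] [FiniteDimensional 𝕜 F]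
    [ChartedSpace F (connectedCentralizer A)] [LieGroup 𝓘(𝕜, F) ∞ (connectedCentralizer A)]
    (hι : ContMDiff 𝓘(𝕜, F) 𝓘(𝕜, E) ∞ (Subtype.val : connectedCentralizer A → G))
    (hinj' : Function.Injective (repDeriv (E := F) (π.comp (connectedCentralizer A).subtype)))
    (X : GroupLieAlgebra 𝓘(𝕜, E) G) (hX : ∀ a ∈ A, Commute (π a) (repDeriv π X)) :
    repDeriv π X ∈ LinearMap.range (repDeriv (E := F) (π.comp (connectedCentralizer A).subtype)) := by
  have : CompleteSpace V := FiniteDimensional.complete 𝕜 V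
  have hσ : ContMDiff 𝓘(𝕜, F) 𝓘(𝕜, V →L[𝕜] V) ∞ (π.comp (connectedCentralizer A).subtype) :=
    hπ.comp hι
  obtain ⟨δ, hδ, γ, hγc, hγ0, hγ⟩ := exists_curve_connectedCentralizer hπ hinj A X hX
  set σ := π.comp (connectedCentralizer A).subtype with hσdef
  have hq := ((contDiffAt_chartRep hσ (mem_extChartAt_target (1 : connectedCentralizer A))).differentiableAt
    (by simp)).hasFDerivAt
  have hmem : ∀ n : ℕ, δ / ((n : ℝ) + 2) ∈ Set.Ioo (-δ) δ := fun n => by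
    have h1 : 0 < δ / ((n : ℝ) + 2) := by positivity
    have h2 : δ / ((n : ℝ) + 2) < δ :=
      div_lt_self hδ (by linarith [(Nat.cast_nonneg n : (0 : ℝ) ≤ n)])
    constructor <;> linarith
  let t : ℕ → Set.Ioo (-δ) δ := fun n => ⟨δ / ((n : ℝ) + 2), hmem n⟩
  have ht : Filter.Tendsto (fun n => γ (t n)) Filter.atTop (nhds 1) := by
    have h0 : Filter.Tendsto t Filter.atTop (nhds ⟨0, by constructor <;> linarith⟩) := by
      rw [tendsto_subtype_rng]
      exact Filter.Tendsto.const_div_atTop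
        (Filter.tendsto_atTop_add_const_right _ _ tendsto_natCast_atTop_atTop) _
    rw [← hγ0 ⟨0, by constructor <;> linarith⟩ rfl]
    exact (hγc.tendsto _).comp h0
  have hc := (continuousAt_extChartAt (I := 𝓘(𝕜, F)) (1 : connectedCentralizer A)).tendsto.comp ht
  have hB := (hasDerivAt_exp_smul_zero (𝕜 := 𝕜) (repDeriv π X)).tendsto_inv_smul_sub δ hδ
  -- The curve is only known to be continuous into H, so the chain rule is replaced by a limit of
  -- difference quotients of σ along it.
  obtain ⟨Y, hY⟩ := mem_range_of_tendsto_smul_sub hq (injective_fderiv_chartRep hσ hinj') hc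
    (s := fun n => (((δ / ((n : ℝ) + 2) : ℝ) : 𝕜))⁻¹) (B := repDeriv π X) (by
      refine hB.congr' ?_
      filter_upwards [ht.eventually (extChartAt_source_mem_nhds (I := 𝓘(𝕜, F))
        (1 : connectedCentralizer A))] with n hn
      rw [chartRep_one, chartRep, Function.comp_apply, Function.comp_apply,
        (extChartAt 𝓘(𝕜, F) (1 : connectedCentralizer A)).left_inv hn, zero_smul,
        NormedSpace.exp_zero]
      exact congrArg (fun S => (((δ / ((n : ℝ) + 2) : ℝ) : 𝕜))⁻¹ • (S - 1)) (hγ (t n)).symm)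
  exact ⟨Y, (repDeriv_apply_eq_fderiv hσ Y).trans hY⟩

end Subgroup

/-! ### The unitary trick. -/

section CompactRealForm

open Matrix

variable {𝕜 : Type*} [RCLike 𝕜]
  {E : Type*} [NormedAddCommGroup E] [NormedSpace 𝕜 E]
  {G : Type*} [Group G] [TopologicalSpace G] [ChartedSpace E G]
  {V : Type*} [NormedAddCommGroup V] [NormedSpace 𝕜 V]

/-- Infinitesimal form of the invariance of a sesquilinear form. -/
lemma conjTranspose_mul_add_mul_eq_zero_of_tendsto {n : Type*} [Fintype n] [DecidableEq n]
    {M : ℕ → Matrix n n 𝕜} {s : ℕ → ℝ} {B P : Matrix n n 𝕜}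
    (hM : Filter.Tendsto M Filter.atTop (nhds 1))
    (hD : Filter.Tendsto (fun k => (((s k : ℝ) : 𝕜))⁻¹ • (M k - 1)) Filter.atTop (nhds B))
    (hinv : ∀ k, (M k)ᴴ * P * M k = P) : Bᴴ * P + P * B = 0 := by
  have hc : Continuous fun p : Matrix n n 𝕜 × Matrix n n 𝕜 => p.1ᴴ * (P * p.2) + P * p.1 :=
    (continuous_fst.matrix_conjTranspose.matrix_mul
      (continuous_const.matrix_mul continuous_snd)).add (continuous_const.matrix_mul continuous_fst)
  have hlim := (hc.tendsto (B, 1)).comp (hD.prodMk_nhds hM)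
  rw [Matrix.mul_one] at hlim
  refine tendsto_nhds_unique hlim (tendsto_const_nhds.congr fun k => ?_)
  have hzero : (M k - 1)ᴴ * (P * M k) + P * (M k - 1) = 0 := by
    rw [conjTranspose_sub, conjTranspose_one, Matrix.sub_mul, ← Matrix.mul_assoc, hinv k,
      Matrix.one_mul, Matrix.mul_sub, Matrix.mul_one, sub_add_sub_cancel, sub_self]
  -- Real parameters are essential: only then does the scalar pass unchanged through the conjugate
  -- transpose.
  have hstar : star (((s k : ℝ) : 𝕜))⁻¹ = (((s k : ℝ) : 𝕜))⁻¹ := by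
    rw [star_inv₀, RCLike.star_def, RCLike.conj_ofReal]
  rw [Function.comp_apply, conjTranspose_smul, hstar, Matrix.smul_mul, Matrix.mul_smul, ← smul_add,
    hzero, smul_zero]

/-- The derivative of `π` along a one-parameter subgroup. -/
lemma hasDerivAt_comp_of_mem_subgroupLie {π : G →* (V →L[𝕜] V)}
    (hπ : ContMDiff 𝓘(𝕜, E) 𝓘(𝕜, V →L[𝕜] V) ∞ π) {K : Subgroup G}
    {Y : GroupLieAlgebra 𝓘(𝕜, E) G} (hY : Y ∈ subgroupLie 𝕜 E K) :
    ∃ γ : 𝕜 → G, γ 0 = 1 ∧ (∀ t : ℝ, γ (t : 𝕜) ∈ K) ∧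
      HasDerivAt (fun s => π (γ s)) (repDeriv π Y) 0 := by
  obtain ⟨γ, hγ, hadd, hder, hK⟩ := hY
  have h0 : γ 0 = 1 := by
    have := hadd 0 0
    rwa [add_zero, left_eq_mul] at this
  refine ⟨γ, h0, hK, ?_⟩
  have hγd : MDifferentiableAt 𝓘(𝕜, 𝕜) 𝓘(𝕜, E) γ 0 := hγ.mdifferentiableAt (by simp)
  have hd : DifferentiableAt 𝕜 (fun s => π (γ s)) 0 :=
    (hπ.comp hγ).contDiff.differentiable (by simp) 0
  have hcomp := mfderiv_comp (I' := 𝓘(𝕜, E)) (0 : 𝕜) (hπ.mdifferentiableAt (by simp)) hγd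
  rw [mfderiv_eq_fderiv] at hcomp
  have h1 : ∀ (y : G) (v : E), y = 1 →
      (mfderiv 𝓘(𝕜, E) 𝓘(𝕜, V →L[𝕜] V) π y : E →L[𝕜] (V →L[𝕜] V)) v = repDeriv (E := E) π v := by
    rintro _ v rfl
    rfl
  have h2 : fderiv 𝕜 (π ∘ γ) 0 1 = repDeriv π Y :=
    (DFunLike.congr_fun hcomp (1 : 𝕜)).trans ((h1 _ _ h0).trans (congrArg _ hder))
  rw [← h2]
  exact hd.hasFDerivAt.hasDerivAt

/-- If the Lie group has a compact real form, then the trace form is non-degenerate on the image of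
the Lie algebra. -/
lemma repDeriv_eq_zero_of_hasCompactRealForm [IsTopologicalGroup G] [FiniteDimensional 𝕜 V]
    {π : G →* (V →L[𝕜] V)}
    (hπ : ContMDiff 𝓘(𝕜, E) 𝓘(𝕜, V →L[𝕜] V) ∞ π) (hG : HasCompactRealForm 𝕜 E G)
    {X : GroupLieAlgebra 𝓘(𝕜, E) G}
    (hX : ∀ Y : GroupLieAlgebra 𝓘(𝕜, E) G, endTraceForm 𝕜 V (repDeriv π X) (repDeriv π Y) = 0) :
    repDeriv π X = 0 := by
  obtain ⟨K, hK, hspan, -⟩ := hG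
  have : CompactSpace K := isCompact_iff_compactSpace.1 hK
  let b := Module.finBasis 𝕜 V
  let toM : (V →L[𝕜] V) →ₗ[𝕜] Matrix _ _ 𝕜 :=
    (LinearMap.toMatrix b b).toLinearMap ∘ₗ ContinuousLinearMap.coeLM 𝕜
  have htoM : Continuous toM := toM.continuous_of_finiteDimensional
  have hmul : ∀ S T, toM (S * T) = toM S * toM T := fun S T => LinearMap.toMatrix_mul b S T
  have hone : toM 1 = 1 := LinearMap.toMatrix_one b
  have hinj : Function.Injective toM :=
    (LinearMap.toMatrix b b).injective.comp ContinuousLinearMap.coe_injective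
  let ρ : K →* Matrix _ _ 𝕜 :=
    { toFun := fun k => toM (π k)
      map_one' := by rw [Subgroup.coe_one, map_one, hone]
      map_mul' := fun k l => by rw [Subgroup.coe_mul, map_mul, hmul] }
  have hρ : Continuous ρ := htoM.comp (hπ.continuous.comp continuous_subtype_val)
  obtain ⟨P, hP, hinv⟩ := exists_posDef_invariant ρ hρ
  have hskew : ∀ Y ∈ subgroupLie 𝕜 E K,
      (toM (repDeriv π Y))ᴴ * P + P * toM (repDeriv π Y) = 0 := by
    intro Y hY
    obtain ⟨γ, hγ0, hγK, hγ⟩ := hasDerivAt_comp_of_mem_subgroupLie hπ hY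
    have h1 := hγ.tendsto_inv_smul_sub 1 one_pos
    have h2 : Filter.Tendsto (fun n : ℕ => π (γ ((1 / ((n : ℝ) + 2) : ℝ) : 𝕜))) Filter.atTop
        (nhds 1) := by
      have hseq : Filter.Tendsto (fun n : ℕ => (1 : ℝ) / ((n : ℝ) + 2)) Filter.atTop (nhds 0) :=
        Filter.Tendsto.const_div_atTop
          (Filter.tendsto_atTop_add_const_right _ _ tendsto_natCast_atTop_atTop) _
      have hseq' := ((RCLike.continuous_ofReal (K := 𝕜)).tendsto 0).comp hseq
      rw [RCLike.ofReal_zero] at hseq'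
      have h := hγ.continuousAt.tendsto.comp hseq'
      rwa [hγ0, map_one] at h
    set M : ℕ → Matrix _ _ 𝕜 := fun n => toM (π (γ ((1 / ((n : ℝ) + 2) : ℝ) : 𝕜))) with hM
    set s : ℕ → ℝ := fun n => 1 / ((n : ℝ) + 2) with hs
    have hD : Filter.Tendsto (fun n => (((s n : ℝ) : 𝕜))⁻¹ • (M n - 1)) Filter.atTop
        (nhds (toM (repDeriv π Y))) := by
      refine ((htoM.tendsto _).comp h1).congr fun n => ?_
      simp only [Function.comp_apply, map_smul, map_sub, hγ0, map_one, hone, hM, hs]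
    have hM1 : Filter.Tendsto M Filter.atTop (nhds 1) := by
      rw [← hone]
      exact (htoM.tendsto _).comp h2
    exact conjTranspose_mul_add_mul_eq_zero_of_tendsto hM1 hD fun n => hinv ⟨_, hγK (s n)⟩
  obtain ⟨Y, hY, Z, hZ, rfl⟩ := hspan X
  -- Y - iZ is chosen because its image is minus the P-adjoint of the image of Y + iZ. Over ℝ, where
  -- `RCLike.I` is 0, both are Y.
  have htr := hX (Y - (RCLike.I : 𝕜) • Z)
  have hYs := hskew Y hY
  have hZs := hskew Z hZ
  refine hinj ((eq_zero_of_trace_mul_of_posDef hP (D := toM (repDeriv π (Y - (RCLike.I : 𝕜) • Z)))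
    ?_ ?_).trans (map_zero toM).symm)
  · simp only [map_add, map_sub, map_smul, conjTranspose_add, conjTranspose_smul, RCLike.star_def,
      RCLike.conj_I, Matrix.add_mul, Matrix.mul_sub, Matrix.smul_mul, Matrix.mul_smul]
    rw [eq_neg_of_add_eq_zero_left hYs, eq_neg_of_add_eq_zero_left hZs]
    simp
  · rw [← hmul]
    rw [endTraceForm_apply, LinearMap.trace_eq_matrix_trace 𝕜 b] at htr
    exact htr

end CompactRealForm

/-! ### Reductive Lie algebras with semisimply acting center. -/

section Reductive

variable {𝕜 : Type*} [RCLike 𝕜]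
  {E : Type*} [NormedAddCommGroup E] [NormedSpace 𝕜 E] [CompleteSpace E]
  {G : Type*} [Group G] [TopologicalSpace G] [ChartedSpace E G] [LieGroup 𝓘(𝕜, E) ∞ G]
  {V : Type*} [NormedAddCommGroup V] [NormedSpace 𝕜 V]

/-- The kernel of the trace form of a representation, as an ideal of the Lie algebra. -/
def traceFormKer (π : G →* (V →L[𝕜] V)) (hπ : ContMDiff 𝓘(𝕜, E) 𝓘(𝕜, V →L[𝕜] V) ∞ π) :
    LieIdeal 𝕜 (GroupLieAlgebra 𝓘(𝕜, E) G) where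
  carrier := {X | ∀ Y : GroupLieAlgebra 𝓘(𝕜, E) G,
    endTraceForm 𝕜 V (repDeriv π X) (repDeriv π Y) = 0}
  add_mem' := fun {X X'} hX hX' Y => by
    rw [map_add, map_add, LinearMap.add_apply, hX Y, hX' Y, add_zero]
  zero_mem' := fun Y => by rw [map_zero, map_zero, LinearMap.zero_apply]
  smul_mem' := fun c X hX Y => by
    rw [map_smul, map_smul, LinearMap.smul_apply, hX Y, smul_zero]
  -- Invariance of the trace form: ([Z, X], Y) = (X, [Y, Z]).
  lie_mem := fun {Z X} hX Y => by
    rw [repDeriv_lie hπ, map_sub, LinearMap.sub_apply, endTraceForm_mul_left (repDeriv π X),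
      ← endTraceForm_mul_right, ← map_sub, ← repDeriv_lie hπ]
    exact hX _

variable [FiniteDimensional 𝕜 E] [FiniteDimensional 𝕜 V] [IsTopologicalGroup G]
  [PreconnectedSpace G]

/-- If the Lie algebra is reductive, the connected center acts semisimply and the kernel of the
trace form acts by nilpotent endomorphisms, then the trace form is non-degenerate. -/
lemma repDeriv_eq_zero_of_isReductiveLieAlgebra {π : G →* (V →L[𝕜] V)}
    (hπ : ContMDiff 𝓘(𝕜, E) 𝓘(𝕜, V →L[𝕜] V) ∞ π)
    (hinj : Function.Injective (repDeriv (E := E) π))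
    (hred : IsReductiveLieAlgebra 𝕜 (GroupLieAlgebra 𝓘(𝕜, E) G))
    (hss : ConnectedCenterActsSemisimply π)
    (hnil : ∀ X ∈ traceFormKer (E := E) π hπ, IsNilpotent (repDeriv π X))
    {X : GroupLieAlgebra 𝓘(𝕜, E) G} (hX : X ∈ traceFormKer π hπ) : repDeriv π X = 0 := by
  have : FiniteDimensional 𝕜 (GroupLieAlgebra 𝓘(𝕜, E) G) := inferInstanceAs (FiniteDimensional 𝕜 E)
  have hrad := le_radical_of_forall_isNilpotent
    (ContinuousLinearMap.coeLM 𝕜 ∘ₗ repDeriv (E := E) π)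
    (ContinuousLinearMap.coe_injective.comp hinj)
    (fun X Y => congrArg ContinuousLinearMap.toLinearMap (repDeriv_lie hπ X Y))
    (traceFormKer π hπ)
    (fun X hX => (hnil X hX).map
      (ContinuousLinearMap.toLinearMapRingHom : (V →L[𝕜] V) →+* Module.End 𝕜 V))
  have hcenter : X ∈ LieAlgebra.center 𝕜 (GroupLieAlgebra 𝓘(𝕜, E) G) := hred ▸ hrad hX
  have hcomm : ∀ g, Commute (repDeriv π X) (π g) := by
    refine commute_of_commute_repDeriv hπ fun Y => ?_
    have h := repDeriv_lie hπ Y X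
    rw [(LieModule.mem_maxTrivSubmodule _ _ _ _).1 hcenter Y, map_zero] at h
    exact (sub_eq_zero.1 h.symm).symm
  -- The centralizer of the whole group is its center, so this curve runs in the connected center.
  obtain ⟨δ, hδ, γ, -, -, hγ⟩ := exists_curve_connectedCentralizer hπ hinj Set.univ X
    fun g _ => (hcomm g).symm
  refine eq_zero_of_isNilpotent_of_isSemisimple_exp (hnil X hX) hδ fun t ht => ?_
  have hz : (γ ⟨t, abs_lt.1 ht⟩ : G) ∈ identityComponent (Subgroup.center G) := by
    rw [← Subgroup.centralizer_univ]
    exact (γ ⟨t, abs_lt.1 ht⟩).2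
  rw [← hγ ⟨t, abs_lt.1 ht⟩]
  exact hss _ hz

end Reductive

theorem theorem2p6 {𝕜 : Type*} [RCLike 𝕜]
    {E : Type*} [NormedAddCommGroup E] [NormedSpace 𝕜 E] [FiniteDimensional 𝕜 E] [CompleteSpace E]
    {G : Type*} [Group G] [TopologicalSpace G] [IsTopologicalGroup G] [ChartedSpace E G]
    [LieGroup 𝓘(𝕜, E) ∞ G]
    {V : Type*} [NormedAddCommGroup V] [NormedSpace 𝕜 V] [FiniteDimensional 𝕜 V]
    (π : G →* (V →L[𝕜] V)) (hsmooth : ContMDiff 𝓘(𝕜, E) 𝓘(𝕜, V →L[𝕜] V) ∞ π)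
    (hπ : AdmitsCayley (E := E) π) (A : Set G)
    {F : Type*} [NormedAddCommGroup F] [NormedSpace 𝕜 F] [FiniteDimensional 𝕜 F] [CompleteSpace F]
    [ChartedSpace F (connectedCentralizer A)] [LieGroup 𝓘(𝕜, F) ∞ (connectedCentralizer A)]
    (hsub : Manifold.IsSmoothEmbedding 𝓘(𝕜, F) 𝓘(𝕜, E) ∞
      (Subtype.val : connectedCentralizer A → G))
    (hred : IsReductiveGroup (E := F) (π.comp (connectedCentralizer A).subtype)) :
    ∃ hπH : AdmitsCayley (E := F) (π.comp (connectedCentralizer A).subtype),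
      ∀ h : connectedCentralizer A,
        cayleyMap π hπ (h : G) =
          mfderiv 𝓘(𝕜, F) 𝓘(𝕜, E) (Subtype.val : connectedCentralizer A → G) 1
            (cayleyMap (π.comp (connectedCentralizer A).subtype) hπH h) := by
  have hσ : ContMDiff 𝓘(𝕜, F) 𝓘(𝕜, V →L[𝕜] V) ∞ (π.comp (connectedCentralizer A).subtype) :=
    hsmooth.comp hsub.contMDiff
  have hσ' := fun Y => repDeriv_comp_subtype hsmooth hsub.contMDiff Y
  have hcent : ∀ h : connectedCentralizer A, ∀ a ∈ A, Commute (π a) (π h) := by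
    intro h a ha
    obtain ⟨c, -, hc⟩ := h.2
    rw [Commute, SemiconjBy, ← map_mul, ← map_mul, ← hc]
    exact congrArg π (Subgroup.mem_centralizer_iff.1 c.2 a ha)
  set σ := π.comp (connectedCentralizer A).subtype with hσdef
  have hinj : Function.Injective (repDeriv (E := F) σ) := by
    intro Y Z h
    rw [hσ', hσ'] at h
    exact (hsub.isImmersion.isImmersionAt 1).injective_mfderiv (hπ.injective h)
  have hrange : ∀ W : V →L[𝕜] V, (∀ a ∈ A, Commute (π a) W) →
      (cayleyProj π hπ W : V →L[𝕜] V) ∈ LinearMap.range (repDeriv (E := F) σ) := by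
    intro W hW
    obtain ⟨X, hX⟩ := (cayleyProj π hπ W).2
    rw [← hX]
    refine mem_range_repDeriv_of_commute hsmooth hπ.injective hsub.contMDiff hinj X fun a ha => ?_
    rw [hX]
    exact commute_cayleyProj hsmooth hπ (hW a ha)
  have hnil : ∀ Y ∈ traceFormKer (E := F) σ hσ, IsNilpotent (repDeriv σ Y) := by
    intro Y hY
    refine (IsNilpotent.map_iff (f := (ContinuousLinearMap.toLinearMapRingHom :
      (V →L[𝕜] V) →+* Module.End 𝕜 V)) ContinuousLinearMap.coe_injective).1
        (isNilpotent_of_trace_pow_succ_eq_zero _ fun k => ?_)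
    -- The power need not lie in σ'(𝔥), but its projection does, and pairing with σ'(Y) ∈ π'(𝔤) does
    -- not see the difference. The case k = 0 gives tr σ'(Y) = 0.
    have hcomm : ∀ a ∈ A, Commute (π a) (repDeriv σ Y ^ k) := fun a ha =>
      (commute_repDeriv hσ (fun h => hcent h a ha) Y).pow_right k
    obtain ⟨Z, hZ⟩ := hrange _ hcomm
    have h1 := endTraceForm_sub_cayleyProj hπ (repDeriv σ Y ^ k)
      (mfderiv 𝓘(𝕜, F) 𝓘(𝕜, E) (Subtype.val : connectedCentralizer A → G) 1 Y)
    have h2 : endTraceForm 𝕜 V (repDeriv σ Y) (repDeriv σ Y ^ k) = 0 := by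
      rw [← hZ, ← hσ' Y, map_sub, hY Z, sub_zero] at h1
      exact h1
    rw [← map_pow, pow_succ']
    exact h2
  have hnondeg : ∀ Y : GroupLieAlgebra 𝓘(𝕜, F) (connectedCentralizer A),
      (∀ Z : GroupLieAlgebra 𝓘(𝕜, F) (connectedCentralizer A),
        endTraceForm 𝕜 V (repDeriv σ Y) (repDeriv σ Z) = 0) → repDeriv σ Y = 0 := by
    intro Y hY
    rcases hred with hcpt | ⟨hlie, hss⟩
    · exact repDeriv_eq_zero_of_hasCompactRealForm hσ hcpt hY
    · exact repDeriv_eq_zero_of_isReductiveLieAlgebra hσ hinj hlie hss hnil hY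
  have hπH : AdmitsCayley (E := F) σ := ⟨hinj, nondegenerate_restrict_of_forall hnondeg⟩
  refine ⟨hπH, fun h => hπ.injective ?_⟩
  -- The projection for π already lies in σ'(𝔥), and its remainder is orthogonal to the larger space
  -- π'(𝔤).
  have hproj : (cayleyProj σ hπH (σ h) : V →L[𝕜] V) = cayleyProj π hπ (π h) := by
    refine cayleyProj_eq_of_forall hπH (hrange _ (hcent h)) fun Y => ?_
    rw [hσ']
    exact endTraceForm_sub_cayleyProj hπ (π h) _
  rw [repDeriv_cayleyMap, ← hproj, ← repDeriv_cayleyMap]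
  exact hσ' _
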